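/- For $m\ge 0$ let $R_m$ be the set of numbers $a+b\sqrt2+ci+di\sqrt2$ with $a,b,c,d\in\mathbb Q$ whose numerators and denominators (in lowest terms) are at most $2^m$ in absolute value. The T-count of an $n$-qubit state is the least number of $T$ gates in a circuit of $H$, $S$, $T$, $\mathrm{CNOT}$ gates on $n$ qubits that produces the state (including its global phase) from $|0\cdots0\rangle$. A Pauli-LIM is $\lambda P_n\otimes\cdots\otimes P_1$ with $\lambda\in\mathbb C$ and $P_j\in\{I,X,Y,Z\}$; $\lambda$ is its numerical coefficient. A Pauli-LIMDD on $n$ qubits is a root edge with a Pauli-LIM label $A$ pointing to a node $v$ of level $n$; it represents $A|v\rangle$. There is one node of level $0$ (the leaf), representing $1$; a node of level $j+1$ has a low and a high edge with labels $A_0,A_1$ to nodes $v_0,v_1$ of level $j$ and represents $|0\rangle\otimes A_0|v_0\rangle+|1\rangle\otimes A_1|v_1\rangle$; equal nodes are merged. An EVDD is such a diagram in which all Pauli strings in labels are identities. Diagrams are assumed normalized: an edge with label $0$ points to the same node as its sibling edge, and the low label of a node is the identity (for an EVDD: it is $1$, or it is $0$ and the high label is $1$). The gate-update algorithms are $\textsc{HGate}$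 (Hadamard gate on one qubit), $\textsc{Add}$ (sum of two edges of equal level), $\textsc{Follow}$ (the edge $\langle x|e\rangle$ for a string $x$ of values of the top qubits), $\textsc{MakeEdge}$ (a normalized edge for $|0\rangle\otimes A|v_0\rangle+|1\rangle\otimes B|v_1\rangle$, where $A\ne0$ or $B\neq 0$) and $\textsc{GetLabels}$ (the canonical high label and the root label for $|0\rangle\otimes|v_0\rangle+|1\rangle\otimes\lambda P|v_1\rangle$, $\lambda\ne0$, by minimization over the automorphism groups $\{g : g|v_i\rangle=|v_i\rangle\}$ of Pauli-LIMs), as given for LIMDDs by Vinkhuijzen et al. (2023), and the same algorithms with identity Pauli strings for EVDDs. They use a fixed total order on nodes and a fixed total order on Pauli-LIMs, both arbitrary here. Theorem. There is an absolute constant $c$ such that the following holds for all $n\ge1$ and $k\ge 0$. Let $D$ be a normalized EVDD or Pauli-LIMDD that represents an $n$-qubit state of T-count $k$. Then every numerical value computed when $\textsc{HGate}$ is run on the root edge of $D$ with any target qubit, or when $\textsc{Add}$, $\textsc{Follow}$, $\textsc{MakeEdge}$ or $\textsc{GetLabels}$ is run on edges of $D$ (for $\textsc{GetLabels}$: on the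 label of an edge of $D$ and nodes of $D$), including all recursive and subroutine calls, lies in $R_{c(n+k)}$. -/

import Mathlib

noncomputable section

namespace QDD

/-! ## Pauli strings and Pauli-LIMs -/

/-- The single-qubit Pauli operators. -/
inductive Pauli : Type
  | I : Pauli
  | X : Pauli
  | Y : Pauli
  | Z : Pauli
  deriving DecidableEq

namespace Pauli

/-- The Pauli operator `P` with `p * q = (phase) * P`. -/
def mul : Pauli → Pauli → Pauli
  | I, q => q
  | p, I => p
  | X, X => I
  | X, Y => Z
  | X, Z => Y
  | Y, X => Z
  | Y, Y => I
  | Y, Z => X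
  | Z, X => Y
  | Z, Y => X
  | Z, Z => I

/-- The power of `i` with `p * q = phase p q * mul p q`. -/
def phase : Pauli → Pauli → ℂ
  | X, Y => Complex.I
  | Y, Z => Complex.I
  | Z, X => Complex.I
  | Y, X => -Complex.I
  | Z, Y => -Complex.I
  | X, Z => -Complex.I
  | _, _ => 1

/-- Whether the operator is anti-diagonal. -/
def flip : Pauli → Bool
  | I => false
  | X => true
  | Y => true
  | Z => false

/-- The only nonzero entry of row `b`, so that `⟨b| p = entry p b ⟨b xor flip p|`. -/
def entry : Pauli → Bool → ℂ
  | I, _ => 1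
  | X, _ => 1
  | Y, false => -Complex.I
  | Y, true => Complex.I
  | Z, false => 1
  | Z, true => -1

/-- `H p H` up to sign (the sign is `-1` exactly for `Y`). -/
def conjH : Pauli → Pauli
  | I => I
  | X => Z
  | Y => Y
  | Z => X

end Pauli

/-- Vectors of `n` qubits; `x (Fin.last _)` is the bit of the top qubit. -/
abbrev QState (n : ℕ) : Type := (Fin n → Bool) → ℂ

/-- A Pauli-LIM `λ P_n ⊗ ⋯ ⊗ P_1` (`λ = 0` allowed: the label of a zero edge);
`pauli i` is the factor of qubit `i + 1`, and `coeff` is its numerical coefficient. -/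
@[ext] structure LIM (n : ℕ) : Type where
  coeff : ℂ
  pauli : Fin n → Pauli

namespace LIM

variable {n : ℕ}

/-- The scalar `z` times the identity string. -/
def scalar (n : ℕ) (z : ℂ) : LIM n := ⟨z, fun _ => Pauli.I⟩

/-- Product of LIMs, the power of `i` being moved into the numerical coefficient. -/
def mul (A B : LIM n) : LIM n :=
  ⟨A.coeff * B.coeff * ∏ i, (A.pauli i).phase (B.pauli i), fun i => (A.pauli i).mul (B.pauli i)⟩

/-- Inverse of a nonzero LIM. -/
def inv (A : LIM n) : LIM n := ⟨A.coeff⁻¹, A.pauli⟩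

/-- The product of the number `z` with `A`. -/
def smul (z : ℂ) (A : LIM n) : LIM n := ⟨z * A.coeff, A.pauli⟩

/-- `p ⊗ A`, where `p` acts on the new top qubit. -/
def tensor (p : Pauli) (A : LIM n) : LIM (n + 1) := ⟨A.coeff, Fin.snoc A.pauli p⟩

/-- `H_k A H_k†`. -/
def conjH (k : Fin n) (A : LIM n) : LIM n :=
  ⟨if A.pauli k = Pauli.Y then -A.coeff else A.coeff,
    Function.update A.pauli k (A.pauli k).conjH⟩

/-- The action of a LIM as a linear operator on vectors. -/
def act (A : LIM n) (ψ : QState n) : QState n := fun x =>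
  A.coeff * (∏ i, (A.pauli i).entry (x i)) * ψ (fun i => xor (x i) (A.pauli i).flip)

end LIM

/-! ## Decision diagrams -/

/-- Nodes of decision diagrams, indexed by their level `index(v)`.  A node of level `n + 1` has a
low and a high edge, each with a label and a target of level `n`.  Nodes are identified when they
are structurally equal, i.e. equal nodes are always merged (unique table). -/
inductive Node : ℕ → Type
  | leaf : Node 0
  | node {n : ℕ} (lowLabel : LIM n) (lowNode : Node n) (highLabel : LIM n) (highNode : Node n) :
      Node (n + 1)

/-- An edge: a label and the node it points to. -/
structure Edge (n : ℕ) : Type where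
  label : LIM n
  node : Node n

/-- The low edge of a node. -/
def Node.low {n : ℕ} : Node (n + 1) → Edge n
  | .node A v _ _ => ⟨A, v⟩

/-- The high edge of a node. -/
def Node.high {n : ℕ} : Node (n + 1) → Edge n
  | .node _ _ B w => ⟨B, w⟩

/-- The vector `|v⟩ = |0⟩ ⊗ A|v₀⟩ + |1⟩ ⊗ B|v₁⟩` represented by a node. -/
def Node.vec : {n : ℕ} → Node n → QState n
  | _, .leaf => fun _ => 1
  | _, .node A v B w => fun x =>
      if x (Fin.last _) then B.act w.vec (Fin.init x) else A.act v.vec (Fin.init x)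

/-- The vector `A|v⟩` represented by an edge. -/
def Edge.vec {n : ℕ} (e : Edge n) : QState n := e.label.act e.node.vec

/-- The two kinds of decision diagrams. -/
inductive Kind : Type
  | evdd : Kind
  | limdd : Kind

/-- The Pauli strings that may occur in a label: only the identity for EVDDs, all for LIMDDs. -/
def Kind.Admits {n : ℕ} : Kind → LIM n → Prop
  | .evdd, A => ∀ i, A.pauli i = Pauli.I
  | .limdd, _ => True

/-- Normalization of the two labels of a node.  For LIMDDs the low label is the identity; for EVDDs
it is `1`, or it is `0` and the high label is `1`. -/
def Kind.Factored {n : ℕ} : Kind → LIM n → LIM n → Prop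
  | .evdd, A, B => A = LIM.scalar n 1 ∨ (A = LIM.scalar n 0 ∧ B = LIM.scalar n 1)
  | .limdd, A, _ => A = LIM.scalar n 1

/-- The diagram below a node is a normalized diagram of the given kind: admissible labels, low
factoring, and a zero edge points to the same node as its sibling. -/
def Node.Normalized (K : Kind) : {n : ℕ} → Node n → Prop
  | _, .leaf => True
  | _, .node A v B w =>
      K.Admits A ∧ K.Admits B ∧ K.Factored A B ∧ (A.coeff = 0 ∨ B.coeff = 0 → v = w) ∧
        v.Normalized K ∧ w.Normalized K

/-- A normalized EVDD or LIMDD, given by its root edge. -/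
def Edge.Normalized (K : Kind) {n : ℕ} (r : Edge n) : Prop :=
  K.Admits r.label ∧ r.node.Normalized K

/-- The edges of the diagram with root edge `r` (including `r`). -/
inductive EdgeOf {n : ℕ} (r : Edge n) : {m : ℕ} → Edge m → Prop
  | root : EdgeOf r r
  | low {m : ℕ} {e : Edge (m + 1)} : EdgeOf r e → EdgeOf r e.node.low
  | high {m : ℕ} {e : Edge (m + 1)} : EdgeOf r e → EdgeOf r e.node.high

/-- The automorphisms of a node: the nonzero LIMs with `g|v⟩ = |v⟩`. -/
def automorphisms (K : Kind) {n : ℕ} (v : Node n) : Set (LIM n) :=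
  {g | g.coeff ≠ 0 ∧ K.Admits g ∧ g.act v.vec = v.vec}

/-- The total orders the algorithms use: the precedence `≼` on nodes and the (lexicographic) order
on LIMs. -/
structure Orders where
  node : ∀ n : ℕ, LinearOrder (Node n)
  lim : ∀ n : ℕ, LinearOrder (LIM n)

/-! ## Executions -/

/-- The outcome of an execution together with the set of all numerical values computed in it. -/
structure Run (α : Type) : Type where
  out : α
  vals : Set ℂ

instance : Monad Run where
  pure a := ⟨a, ∅⟩
  bind r f := ⟨(f r.out).out, r.vals ∪ (f r.out).vals⟩

/-- Record numerical values. -/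
def emit (S : Set ℂ) : Run Unit := ⟨(), S⟩

/-- Compute a LIM, recording its numerical coefficient. -/
def compute {n : ℕ} (A : LIM n) : Run (LIM n) := ⟨A, {A.coeff}⟩

/-- The edge `A · e`. -/
def mulEdge {n : ℕ} (A : LIM n) (e : Edge n) : Run (Edge n) := do
  let B ← compute (A.mul e.label)
  pure ⟨B, e.node⟩

open Classical in
/-- A minimizer of `f` on `S` for the order `le` (`d` if there is none). -/
def argMin {α β : Type} (le : β → β → Prop) (f : α → β) (S : Set α) (d : α) : α :=
  if h : ∃ a ∈ S, ∀ b ∈ S, le (f a) (f b) then h.choose else d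

/-- `RootLabel(A v)`: the least LIM `A g` with `g` an automorphism of `v`. -/
def rootLabel (O : Orders) (K : Kind) {n : ℕ} (e : Edge n) : Run (LIM n) := do
  emit {z | ∃ g ∈ automorphisms K e.node, z = g.coeff ∨ z = (e.label.mul g).coeff}
  compute (e.label.mul
    (argMin (O.lim n).le (fun g => e.label.mul g) (automorphisms K e.node) (LIM.scalar n 1)))

/-- `Follow`: for `e = λ P_{n+m} ⊗ ⋯ ⊗ P_1 v` and bits `x`, with `x (Fin.last _)` the top one, the
edge for `⟨x|e⟩`.  Here `γ ⟨y| = ⟨x| λ P_{n+m} ⊗ ⋯ ⊗ P_{n+1}`. -/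
def follow (n : ℕ) : (m : ℕ) → Edge (n + m) → (Fin m → Bool) → Run (Edge n)
  | 0, e, _ => do
      emit {e.label.coeff}
      pure e
  | m + 1, e, x => do
      let p : Fin (m + 1) → Pauli := fun j => e.label.pauli (Fin.natAdd n j)
      let γ : ℂ := e.label.coeff * ∏ j, (p j).entry (x j)
      let y : Fin (m + 1) → Bool := fun j => xor (x j) (p j).flip
      emit {e.label.coeff, γ}
      let f ← follow n m (if y (Fin.last m) then e.node.high else e.node.low) (Fin.init y)
      mulEdge ⟨γ, fun i => e.label.pauli (Fin.castAdd (m + 1) i)⟩ f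

open Classical in
/-- `GetLabels(λP, v₀, v₁)`: returns the high label and the root label.  For EVDDs the only
automorphism is the identity and the operators `X`, `Z` are not available, so that the label is
kept. -/
def getLabels (O : Orders) {n : ℕ} : Kind → LIM n → Node n → Node n → Run (LIM n × LIM (n + 1))
  | .evdd, L, _, _ => do
      let high ← compute L
      let root ← compute (LIM.scalar (n + 1) 1)
      pure (high, root)
  | .limdd, L, v₀, v₁ => do
      let G₀ : Set (LIM n) := automorphisms .limdd v₀
      let G₁ : Set (LIM n) := automorphisms .limdd v₁
      emit {z | ∃ g₀ ∈ G₀, ∃ g₁ ∈ G₁,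
        z = g₀.coeff ∨ z = g₁.coeff ∨ z = ((g₀.mul L).mul g₁).coeff}
      let g : LIM n × LIM n := argMin (O.lim n).le (fun g => (g.1.mul L).mul g.2)
        (G₀ ×ˢ G₁) (LIM.scalar n 1, LIM.scalar n 1)
      -- `(-1)^s λ^((-1)^x) g₀ P g₁`
      let cand : Bool × Bool → LIM n := fun t =>
        LIM.smul (if t.2 then -1 else 1)
          ((g.1.mul ⟨if t.1 then L.coeff⁻¹ else L.coeff, L.pauli⟩).mul g.2)
      let T : Set (Bool × Bool) := if v₀ = v₁ then Set.univ else {t | t.1 = false}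
      emit {z | ∃ t ∈ T, z = (cand t).coeff}
      let t : Bool × Bool := argMin (O.lim n).le cand T (false, false)
      let high ← compute (cand t)
      -- `(X ⊗ λP)^x · (Z^s ⊗ g₀⁻¹)`
      let l ← compute (if t.1 then L.tensor Pauli.X else LIM.scalar (n + 1) 1)
      let r ← compute (LIM.tensor (if t.2 then Pauli.Z else Pauli.I) g.1.inv)
      let root ← compute (l.mul r)
      pure (high, root)

open Classical in
/-- `MakeEdge(A v₀, B v₁)` when `A ≠ 0` and the edges are already in the right order. -/
def makeEdgeOrdered (O : Orders) (K : Kind) {n : ℕ} (e₀ e₁ : Edge n) : Run (Edge (n + 1)) :=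
  if e₁.label.coeff = 0 then do
    let root ← compute (e₀.label.tensor Pauli.I)
    emit {0, 1}
    pure ⟨root, .node (LIM.scalar n 1) e₀.node (LIM.scalar n 0) e₀.node⟩
  else do
    let Ai ← compute e₀.label.inv
    let L ← compute (Ai.mul e₁.label)
    let hr ← getLabels O K L e₀.node e₁.node
    let root ← compute ((e₀.label.tensor Pauli.I).mul hr.2)
    emit {1}
    pure ⟨root, .node (LIM.scalar n 1) e₀.node hr.1 e₁.node⟩

open Classical in
/-- `MakeEdge(A v₀, B v₁)`, an edge for `|0⟩ ⊗ A|v₀⟩ + |1⟩ ⊗ B|v₁⟩`.  If both labels vanish, the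
result is a zero edge.  For LIMDDs the two edges are swapped with an `X` on the top qubit if
`A = 0`, or if both labels are nonzero and `v₀ ⋠ v₁`.  For EVDDs there is no swap, and in the case
`A = 0` the factor `B` is pulled out of the high edge. -/
def makeEdge (O : Orders) (K : Kind) {n : ℕ} (e₀ e₁ : Edge n) : Run (Edge (n + 1)) := do
  emit {e₀.label.coeff, e₁.label.coeff}
  if e₀.label.coeff = 0 ∧ e₁.label.coeff = 0 then do
    emit {0, 1}
    pure ⟨LIM.scalar (n + 1) 0, .node (LIM.scalar n 1) e₀.node (LIM.scalar n 0) e₀.node⟩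
  else
    match K with
    | .evdd =>
        if e₀.label.coeff = 0 then do
          let root ← compute (e₁.label.tensor Pauli.I)
          emit {0, 1}
          pure ⟨root, .node (LIM.scalar n 0) e₁.node (LIM.scalar n 1) e₁.node⟩
        else makeEdgeOrdered O .evdd e₀ e₁
    | .limdd =>
        if e₀.label.coeff = 0 ∨ (e₁.label.coeff ≠ 0 ∧ ¬ (O.node n).le e₀.node e₁.node) then do
          let e ← makeEdgeOrdered O .limdd e₁ e₀
          mulEdge ((LIM.scalar n 1).tensor Pauli.X) e
        else makeEdgeOrdered O .limdd e₀ e₁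

open Classical in
/-- `Add(A v, B w)`, an edge for `A|v⟩ + B|w⟩`; if `A = 0` or `B = 0`, the other edge is returned.
Caches only avoid repeating a computation that was already made, and are left out. -/
def add (O : Orders) (K : Kind) : (n : ℕ) → Edge n → Edge n → Run (Edge n)
  | 0, e, f => do
      emit {e.label.coeff, f.label.coeff}
      let C ← compute (LIM.scalar 0 (e.label.coeff + f.label.coeff))
      pure ⟨C, .leaf⟩
  | n + 1, e, f => do
      emit {e.label.coeff, f.label.coeff}
      if e.label.coeff = 0 then pure f
      else if f.label.coeff = 0 then pure e
      else do
        let e' : Edge (n + 1) := if (O.node (n + 1)).le e.node f.node then e else f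
        let f' : Edge (n + 1) := if (O.node (n + 1)).le e.node f.node then f else e
        let Ai ← compute e'.label.inv
        let AiB ← compute (Ai.mul f'.label)
        let C ← rootLabel O K ⟨AiB, f'.node⟩
        let v₀ ← follow n 1 ⟨LIM.scalar (n + 1) 1, e'.node⟩ (fun _ => false)
        let w₀ ← follow n 1 ⟨C, f'.node⟩ (fun _ => false)
        let a₀ ← add O K n v₀ w₀
        let v₁ ← follow n 1 ⟨LIM.scalar (n + 1) 1, e'.node⟩ (fun _ => true)
        let w₁ ← follow n 1 ⟨C, f'.node⟩ (fun _ => true)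
        let a₁ ← add O K n v₁ w₁
        let a ← makeEdge O K a₀ a₁
        mulEdge e'.label a

open Classical in
/-- `HGate(A v, k)`: the Hadamard gate applied to the qubit with index `k` (the top qubit being
`Fin.last _`).  The cache is left out, as for `add`. -/
def hGate (O : Orders) (K : Kind) : (n : ℕ) → Edge n → Fin n → Run (Edge n)
  | 0, e, _ => pure e
  | n + 1, e, k => do
      emit {e.label.coeff}
      let c ←
        if h : k = Fin.last n then do
          let a₀ ← add O K n e.node.low e.node.high
          let M ← compute (e.node.high.label.smul (-1))
          let a₁ ← add O K n e.node.low ⟨M, e.node.high.node⟩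
          let a ← makeEdge O K a₀ a₁
          let s ← compute (LIM.scalar (n + 1) (1 / (Real.sqrt 2 : ℂ)))
          mulEdge s a
        else do
          let a₀ ← hGate O K n e.node.low (k.castPred h)
          let a₁ ← hGate O K n e.node.high (k.castPred h)
          makeEdge O K a₀ a₁
      let B ← compute (e.label.conjH k)
      mulEdge B c

/-- `Computed O K r z`: the number `z` is computed when one of the algorithms is run on the diagram
with root edge `r`: `HGate` on the root edge with any target qubit, or `Add`, `Follow`, `MakeEdge`
or `GetLabels` on edges of the diagram. -/
inductive Computed (O : Orders) (K : Kind) {n : ℕ} (r : Edge n) : ℂ → Prop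
  | hGate (k : Fin n) {z : ℂ} (hz : z ∈ (hGate O K n r k).vals) : Computed O K r z
  | add {m : ℕ} {e f : Edge m} (he : EdgeOf r e) (hf : EdgeOf r f) {z : ℂ}
      (hz : z ∈ (add O K m e f).vals) : Computed O K r z
  | follow {l m : ℕ} {e : Edge (l + m)} (he : EdgeOf r e) (x : Fin m → Bool) {z : ℂ}
      (hz : z ∈ (follow l m e x).vals) : Computed O K r z
  | makeEdge {m : ℕ} {e f : Edge m} (he : EdgeOf r e) (hf : EdgeOf r f)
      (h : e.label.coeff ≠ 0 ∨ f.label.coeff ≠ 0) {z : ℂ}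
      (hz : z ∈ (makeEdge O K e f).vals) : Computed O K r z
  | getLabels {m : ℕ} {e f : Edge m} (he : EdgeOf r e) (hf : EdgeOf r f)
      (h : f.label.coeff ≠ 0) {z : ℂ}
      (hz : z ∈ (getLabels O K f.label e.node f.node).vals) : Computed O K r z

/-! ## Clifford+T circuits and the T-count of a state -/

/-- The gates of Clifford+T circuits. -/
inductive Gate (n : ℕ) : Type
  | H (i : Fin n) : Gate n
  | S (i : Fin n) : Gate n
  | T (i : Fin n) : Gate n
  | CNOT (c t : Fin n) (h : c ≠ t) : Gate n

/-- The unitary of a gate. -/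
def Gate.apply {n : ℕ} : Gate n → QState n → QState n
  | .H i, ψ => fun x =>
      (ψ (Function.update x i false) + (if x i then -1 else 1) * ψ (Function.update x i true))
        / (Real.sqrt 2 : ℂ)
  | .S i, ψ => fun x => (if x i then Complex.I else 1) * ψ x
  | .T i, ψ => fun x => (if x i then Complex.exp (Complex.I * Real.pi / 4) else 1) * ψ x
  | .CNOT c t _, ψ => fun x => ψ (Function.update x t (xor (x t) (x c)))

/-- Whether a gate is a `T` gate. -/
def Gate.isT {n : ℕ} : Gate n → Bool
  | .T _ => true
  | _ => false

/-- The state `|0⋯0⟩`. -/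
def zeroState (n : ℕ) : QState n := fun x => if x = fun _ => false then 1 else 0

/-- The state that a circuit (first gate first) produces from `|0⋯0⟩`. -/
def output {n : ℕ} (C : List (Gate n)) : QState n :=
  C.foldl (fun ψ g => g.apply ψ) (zeroState n)

/-- `φ` is a state of T-count `k`: the least number of `T` gates of a Clifford+T circuit that
produces `φ` from `|0⋯0⟩`. -/
def HasTCount {n : ℕ} (φ : QState n) (k : ℕ) : Prop :=
  IsLeast {t : ℕ | ∃ C : List (Gate n), output C = φ ∧ C.countP Gate.isT = t} k

/-! ## The sets of representable numbers -/

/-- `R m`: the numbers `a + b√2 + ci + di√2` with rational `a, b, c, d` whose numerators and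
denominators are at most `2 ^ m` in absolute value. -/
def R (m : ℕ) : Set ℂ :=
  {z | ∃ a b c d : ℚ, (∀ q ∈ [a, b, c, d], q.num.natAbs ≤ 2 ^ m ∧ q.den ≤ 2 ^ m) ∧
    z = a + b * (Real.sqrt 2 : ℂ) + c * Complex.I + d * Complex.I * (Real.sqrt 2 : ℂ)}

end QDD

end

noncomputable section

namespace QDD

open Pointwise

/-! ## Fourth roots of unity -/

/-! Two facts carry the theorem: every computed number is a fixed arithmetic expression, up to
powers of `i`, in boundedly many amplitudes of the state, and these amplitudes have height linear in
`n + k`.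

Diagrams. At each node of a normalized diagram one of the two labels is `1`, so by descent the
vector of the node has an entry `1` (`Monic`). A Pauli string is a monomial matrix whose entries are
powers of `i`. Hence the coefficient of an edge to a monic node is, up to a power of `i`, an entry
of the vector that the edge represents (`Monic.coeff_mem`), and automorphisms of monic nodes have
coefficient `±1` (`Monic.coeff_automorphism`). Labels therefore need not be traced through the
recursion, where bounds on products would grow with the depth: it suffices to know which vectors are
represented. The vector of a node is made of amplitudes divided by a common amplitude, up to powers
of `i` (`Node.Normalized.tame`). The edges met in a run represent parts of such vectors, sums of two
of them over a common denominator (`add_spec`), or their Hadamard transforms (`hGate_spec`), up to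
rescaling. So all values lie in `Amplitudes G / Amplitudes G`, where `G` consists of `0`, `1` and
the amplitudes, times powers of `i`. The orders on nodes and labels are irrelevant, since every
admissible choice satisfies the same bounds.

Circuits. The gates `H`, `S`, `CNOT` preserve the Barnes–Wall lattice over `ℤ[ω]`, and `T` does so
after multiplication by `√2` (`outputOver_mem_lattice`); thus `2 ^ (n + k)` times an amplitude lies
in `ℤ[ω]`. Its integer coordinates are bounded because the conjugation `√2 ↦ -√2` that fixes `i`
turns the circuit into another norm-preserving one, so that both conjugates of an amplitude have
absolute value at most `1` (`output_mem_height`).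

Finally, each field operation in `ℚ(i, √2)` changes the height at most linearly, and the number of
operations is bounded. -/

/-- A set of numbers is phase closed if it is closed under multiplication by `i`. -/
def PhaseClosed (U : Set ℂ) : Prop := ∀ z ∈ U, Complex.I * z ∈ U

theorem pow_four_eq_one_cases {u : ℂ} (hu : u ^ 4 = 1) :
    u = 1 ∨ u = -1 ∨ u = Complex.I ∨ u = -Complex.I := by
  have h : (u - 1) * (u + 1) * ((u - Complex.I) * (u + Complex.I)) = 0 := by
    linear_combination hu + (1 - u ^ 2) * Complex.I_sq
  rcases mul_eq_zero.1 h with h | h <;> rcases mul_eq_zero.1 h with h | h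
  · exact Or.inl (sub_eq_zero.1 h)
  · exact Or.inr (Or.inl (eq_neg_of_add_eq_zero_left h))
  · exact Or.inr (Or.inr (Or.inl (sub_eq_zero.1 h)))
  · exact Or.inr (Or.inr (Or.inr (eq_neg_of_add_eq_zero_left h)))

theorem PhaseClosed.mul_mem {U : Set ℂ} (hU : PhaseClosed U) {u z : ℂ} (hu : u ^ 4 = 1)
    (hz : z ∈ U) : u * z ∈ U := by
  have h2 : -1 * z ∈ U := by
    have := hU _ (hU _ hz)
    rwa [← mul_assoc, Complex.I_mul_I] at this
  rcases pow_four_eq_one_cases hu with rfl | rfl | rfl | rfl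
  · simpa using hz
  · exact h2
  · exact hU _ hz
  · have := hU _ h2
    convert this using 1
    ring

theorem PhaseClosed.mem_of_pow_four {U : Set ℂ} (hU : PhaseClosed U) (h1 : (1 : ℂ) ∈ U) {u : ℂ}
    (hu : u ^ 4 = 1) : u ∈ U := by
  simpa using hU.mul_mem hu h1

theorem PhaseClosed.mem_of_mul_mem {U : Set ℂ} (hU : PhaseClosed U) {u z : ℂ} (hu : u ^ 4 = 1)
    (hz : u * z ∈ U) : z ∈ U := by
  have h := hU.mul_mem (u := u ^ 3) (by rw [← pow_mul, mul_comm, pow_mul, hu, one_pow]) hz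
  rwa [← mul_assoc, ← pow_succ, hu, one_mul] at h

namespace Pauli

theorem entry_pow_four (p : Pauli) (b : Bool) : p.entry b ^ 4 = 1 := by
  cases p <;> cases b <;> norm_num [entry]

theorem phase_pow_four (p q : Pauli) : p.phase q ^ 4 = 1 := by
  cases p <;> cases q <;> norm_num [phase]

theorem phase_self (p : Pauli) : p.phase p = 1 := by
  cases p <;> rfl

theorem mul_self (p : Pauli) : p.mul p = I := by
  cases p <;> rfl

theorem flip_mul (p q : Pauli) : (p.mul q).flip = xor p.flip q.flip := by
  cases p <;> cases q <;> rfl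

theorem phase_mul_entry (p q : Pauli) (b : Bool) :
    p.phase q * (p.mul q).entry b = p.entry b * q.entry (xor b p.flip) := by
  cases p <;> cases q <;> cases b <;> simp [phase, mul, entry, flip]

end Pauli

/-! ## The action of Pauli-LIMs -/

namespace LIM

variable {n : ℕ}

theorem scalar_act (z : ℂ) (ψ : QState n) : (scalar n z).act ψ = fun x => z * ψ x := by
  funext x
  simp [scalar, act, Pauli.entry, Pauli.flip]

theorem scalar_one_act (ψ : QState n) : (scalar n 1).act ψ = ψ := by
  simp [scalar_act]

theorem act_of_coeff_eq_zero {A : LIM n} (hA : A.coeff = 0) (ψ : QState n) :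
    A.act ψ = fun _ => 0 := by
  funext x
  simp [act, hA]

theorem act_zero (A : LIM n) : A.act (fun _ => 0) = fun _ => 0 := by
  funext x
  simp [act]

theorem mul_act (A B : LIM n) (ψ : QState n) : (A.mul B).act ψ = A.act (B.act ψ) := by
  funext x
  have h1 : (∏ i, (A.pauli i).phase (B.pauli i)) * ∏ i, ((A.pauli i).mul (B.pauli i)).entry (x i)
      = (∏ i, (A.pauli i).entry (x i)) *
        ∏ i, (B.pauli i).entry (xor (x i) (A.pauli i).flip) := by
    rw [← Finset.prod_mul_distrib, ← Finset.prod_mul_distrib]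
    exact Finset.prod_congr rfl fun i _ => Pauli.phase_mul_entry _ _ _
  simp only [act, mul, Pauli.flip_mul, Bool.xor_assoc]
  linear_combination (A.coeff * B.coeff *
    ψ (fun i => xor (x i) (xor (A.pauli i).flip (B.pauli i).flip))) * h1

theorem act_smul (A : LIM n) (z : ℂ) (ψ : QState n) :
    A.act (fun x => z * ψ x) = fun x => z * A.act ψ x := by
  funext x
  simp only [act]
  ring

theorem act_add (A : LIM n) (ψ φ : QState n) :
    A.act (fun x => ψ x + φ x) = fun x => A.act ψ x + A.act φ x := by
  funext x
  simp only [act]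
  ring

theorem smul_act (z : ℂ) (A : LIM n) (ψ : QState n) :
    (smul z A).act ψ = fun x => z * A.act ψ x := by
  funext x
  simp only [act, smul]
  ring

theorem mk_act (z : ℂ) (p : Fin n → Pauli) (ψ : QState n) :
    (⟨z, p⟩ : LIM n).act ψ = fun x => z * (⟨1, p⟩ : LIM n).act ψ x := by
  funext x
  simp only [act]
  ring

theorem mk_one_act_act (p : Fin n → Pauli) (ψ : QState n) :
    (⟨1, p⟩ : LIM n).act ((⟨1, p⟩ : LIM n).act ψ) = ψ := by
  rw [← mul_act]
  have : (⟨1, p⟩ : LIM n).mul ⟨1, p⟩ = scalar n 1 := by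
    ext <;> simp [mul, scalar, Pauli.phase_self, Pauli.mul_self]
  rw [this, scalar_one_act]

theorem mk_act_mk_act (z w : ℂ) (p : Fin n → Pauli) (ψ : QState n) :
    (⟨z, p⟩ : LIM n).act ((⟨w, p⟩ : LIM n).act ψ) = fun x => z * w * ψ x := by
  rw [mk_act, mk_act w, act_smul, mk_one_act_act]
  funext x
  ring

theorem inv_act_act {A : LIM n} (hA : A.coeff ≠ 0) (ψ : QState n) :
    A.inv.act (A.act ψ) = ψ := by
  refine (mk_act_mk_act A.coeff⁻¹ A.coeff A.pauli ψ).trans ?_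
  simp [inv_mul_cancel₀ hA]

theorem act_inv_act {A : LIM n} (hA : A.coeff ≠ 0) (ψ : QState n) :
    A.act (A.inv.act ψ) = ψ := by
  refine (mk_act_mk_act A.coeff A.coeff⁻¹ A.pauli ψ).trans ?_
  simp [mul_inv_cancel₀ hA]

theorem prod_pow_four {ι : Type*} (s : Finset ι) (f : ι → ℂ) (h : ∀ i, f i ^ 4 = 1) :
    (∏ i ∈ s, f i) ^ 4 = 1 := by
  rw [← Finset.prod_pow]
  exact Finset.prod_eq_one fun i _ => h i

/-- Phases of Pauli products are powers of `i`, which a phase closed set does not see; the later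
bounds need no more about products of labels than this. -/
theorem mul_coeff (A B : LIM n) :
    ∃ u : ℂ, u ^ 4 = 1 ∧ (A.mul B).coeff = u * (A.coeff * B.coeff) :=
  ⟨_, prod_pow_four Finset.univ _ fun i => Pauli.phase_pow_four (A.pauli i) (B.pauli i),
    mul_comm _ _⟩

theorem exists_act_eq (A : LIM n) (ψ : QState n) (x : Fin n → Bool) :
    ∃ u : ℂ, u ^ 4 = 1 ∧ ∃ y, A.act ψ x = u * (A.coeff * ψ y) :=
  ⟨_, prod_pow_four Finset.univ _ fun i => Pauli.entry_pow_four (A.pauli i) (x i), _, by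
    simp only [act]
    ring⟩

/-- A Pauli string permutes the basis vectors up to powers of `i`, so each entry of `ψ` survives
somewhere in the image. -/
theorem exists_eq_act (A : LIM n) (ψ : QState n) (y : Fin n → Bool) :
    ∃ u : ℂ, u ^ 4 = 1 ∧ ∃ x, A.act ψ x = u * (A.coeff * ψ y) := by
  refine ⟨_, prod_pow_four Finset.univ _ fun i =>
    Pauli.entry_pow_four (A.pauli i) (xor (y i) (A.pauli i).flip),
    fun i => xor (y i) (A.pauli i).flip, ?_⟩
  simp only [act, Bool.xor_assoc, Bool.xor_self, Bool.xor_false]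
  ring

end LIM

/-! ## Splitting off the top qubit -/

section Top

variable {n : ℕ}

/-- The vector `|0⟩ ⊗ ψ + |1⟩ ⊗ φ`. -/
def join (ψ φ : QState n) : QState (n + 1) := fun x =>
  if x (Fin.last n) then φ (Fin.init x) else ψ (Fin.init x)

/-- The vector `⟨b|ψ⟩`, where `b` is the value of the top qubit. -/
def top (b : Bool) (ψ : QState (n + 1)) : QState n := fun y => ψ (Fin.snoc y b)

theorem top_join (b : Bool) (ψ φ : QState n) : top b (join ψ φ) = if b then φ else ψ := by
  cases b <;> funext y <;> simp [top, join]

theorem ext_top {ψ φ : QState (n + 1)} (h : ∀ b, top b ψ = top b φ) : ψ = φ := by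
  funext x
  have := congrFun (h (x (Fin.last n))) (Fin.init x)
  simpa [top] using this

theorem join_top (ψ : QState (n + 1)) : join (top false ψ) (top true ψ) = ψ :=
  ext_top fun b => by cases b <;> simp [top_join]

theorem forall_join {ψ φ : QState n} {U : Set ℂ} (hψ : ∀ x, ψ x ∈ U) (hφ : ∀ x, φ x ∈ U) (x) :
    join ψ φ x ∈ U := by
  simp only [join]
  split
  · exact hφ _
  · exact hψ _

theorem LIM.top_tensor_act (b : Bool) (p : Pauli) (A : LIM n) (ψ : QState (n + 1)) :
    top b ((A.tensor p).act ψ) =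
      fun y => p.entry b * A.act (top (xor b p.flip) ψ) y := by
  funext y
  have h : (fun i => xor ((Fin.snoc y b : Fin (n + 1) → Bool) i)
      ((Fin.snoc A.pauli p : Fin (n + 1) → Pauli) i).flip)
      = Fin.snoc (fun i => xor (y i) (A.pauli i).flip) (xor b p.flip) := by
    funext i
    refine Fin.lastCases ?_ (fun i => ?_) i <;> simp
  simp only [top, LIM.act, LIM.tensor, Fin.prod_univ_castSucc, Fin.snoc_castSucc, Fin.snoc_last]
  rw [h]
  ring

theorem LIM.tensor_I_act_join (A : LIM n) (ψ φ : QState n) :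
    (A.tensor Pauli.I).act (join ψ φ) = join (A.act ψ) (A.act φ) :=
  ext_top fun b => by
    rw [LIM.top_tensor_act]
    cases b <;> simp [top_join, Pauli.entry, Pauli.flip]

theorem LIM.tensor_X_act_join (A : LIM n) (ψ φ : QState n) :
    (A.tensor Pauli.X).act (join ψ φ) = join (A.act φ) (A.act ψ) :=
  ext_top fun b => by
    rw [LIM.top_tensor_act]
    cases b <;> simp [top_join, Pauli.entry, Pauli.flip]

theorem LIM.tensor_Z_act_join (A : LIM n) (ψ φ : QState n) :
    (A.tensor Pauli.Z).act (join ψ φ) = join (A.act ψ) (fun x => -1 * A.act φ x) :=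
  ext_top fun b => by
    rw [LIM.top_tensor_act]
    cases b <;> simp [top_join, Pauli.entry, Pauli.flip]

/-- The two edges of a node. -/
def Node.child (v : Node (n + 1)) (b : Bool) : Edge n := if b then v.high else v.low

theorem Node.vec_eq_join (v : Node (n + 1)) : v.vec = join v.low.vec v.high.vec := by
  cases v
  rfl

theorem Node.top_vec (v : Node (n + 1)) (b : Bool) : top b v.vec = (v.child b).vec := by
  rw [v.vec_eq_join, top_join]
  cases b <;> rfl

end Top

/-! ## Values of runs -/

section Run

variable {α β : Type}

@[simp] theorem vals_bind (r : Run α) (f : α → Run β) :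
    (r >>= f).vals = r.vals ∪ (f r.out).vals := rfl

@[simp] theorem out_bind (r : Run α) (f : α → Run β) : (r >>= f).out = (f r.out).out := rfl

@[simp] theorem vals_pure (a : α) : (pure a : Run α).vals = ∅ := rfl

@[simp] theorem out_pure (a : α) : (pure a : Run α).out = a := rfl

@[simp] theorem vals_emit (S : Set ℂ) : (emit S).vals = S := rfl

@[simp] theorem vals_compute {n : ℕ} (A : LIM n) : (compute A).vals = {A.coeff} := rfl

@[simp] theorem out_compute {n : ℕ} (A : LIM n) : (compute A).out = A := rfl

@[simp] theorem vals_mulEdge {n : ℕ} (A : LIM n) (e : Edge n) :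
    (mulEdge A e).vals = {(A.mul e.label).coeff} := by
  simp [mulEdge]

@[simp] theorem out_mulEdge {n : ℕ} (A : LIM n) (e : Edge n) :
    (mulEdge A e).out = ⟨A.mul e.label, e.node⟩ := by
  simp [mulEdge]

theorem vec_mulEdge {n : ℕ} (A : LIM n) (e : Edge n) :
    (mulEdge A e).out.vec = A.act e.vec := by
  simp [Edge.vec, LIM.mul_act]

theorem argMin_mem (le : β → β → Prop) (f : α → β) {S : Set α} {d : α} (hd : d ∈ S) :
    argMin le f S d ∈ S := by
  unfold argMin
  split
  · next h => exact h.choose_spec.1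
  · exact hd

end Run

/-! ## Monic nodes and automorphisms -/

/-- Some entry of the vector of the node is `1`. -/
def Monic {n : ℕ} (v : Node n) : Prop := ∃ x, v.vec x = 1

/-- The entry `1` of the node reappears in the edge vector as the coefficient times a power of `i`.
This reads a label off the represented vector, however the label was computed. The factor `c` allows
a denominator to be cleared first. -/
theorem Monic.coeff_mem {n : ℕ} {e : Edge n} (h : Monic e.node) {U : Set ℂ} (hU : PhaseClosed U)
    {c : ℂ} (he : ∀ x, c * e.vec x ∈ U) : c * e.label.coeff ∈ U := by
  obtain ⟨y, hy⟩ := h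
  obtain ⟨u, hu, x, hx⟩ := LIM.exists_eq_act e.label e.node.vec y
  have := he x
  rw [Edge.vec, hx, hy, mul_one, mul_left_comm] at this
  exact hU.mem_of_mul_mem hu this

theorem Monic.coeff_mem' {n : ℕ} {e : Edge n} (h : Monic e.node) {U : Set ℂ} (hU : PhaseClosed U)
    (he : ∀ x, e.vec x ∈ U) : e.label.coeff ∈ U := by
  simpa using h.coeff_mem hU (c := 1) (by simpa using he)

theorem Monic.of_low {n : ℕ} {v : Node n} (h : Monic v) (B : LIM n) (w : Node n) :
    Monic (.node (LIM.scalar n 1) v B w) := by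
  obtain ⟨y, hy⟩ := h
  refine ⟨Fin.snoc y false, ?_⟩
  refine (congrFun (Node.top_vec (.node (LIM.scalar n 1) v B w) false) y).trans ?_
  simpa [Node.child, Node.low, Edge.vec, LIM.scalar_one_act] using hy

theorem Monic.of_high {n : ℕ} {w : Node n} (h : Monic w) (A : LIM n) (v : Node n) :
    Monic (.node A v (LIM.scalar n 1) w) := by
  obtain ⟨y, hy⟩ := h
  refine ⟨Fin.snoc y true, ?_⟩
  refine (congrFun (Node.top_vec (.node A v (LIM.scalar n 1) w) true) y).trans ?_
  simpa [Node.child, Node.high, Edge.vec, LIM.scalar_one_act] using hy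

theorem one_mem_automorphisms (K : Kind) {n : ℕ} (v : Node n) :
    LIM.scalar n 1 ∈ automorphisms K v := by
  refine ⟨one_ne_zero, ?_, LIM.scalar_one_act _⟩
  cases K
  · exact fun _ => rfl
  · trivial

/-- For `g = λP` one has `g² = λ²`, because `P² = 1`. Comparing the entry `1` of `g²|v⟩ = |v⟩` gives
`λ² = 1`. -/
theorem Monic.coeff_automorphism {n : ℕ} {v : Node n} (h : Monic v) {K : Kind} {g : LIM n}
    (hg : g ∈ automorphisms K v) : g.coeff ^ 4 = 1 := by
  obtain ⟨y, hy⟩ := h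
  have h1 : g.act (g.act v.vec) = v.vec := by rw [hg.2.2, hg.2.2]
  have h2 := congrFun ((LIM.mk_act_mk_act g.coeff g.coeff g.pauli v.vec).symm.trans h1) y
  rw [hy, mul_one] at h2
  linear_combination (g.coeff ^ 2 + 1) * h2

/-! ## Tame nodes and `Follow` -/

/-- Hereditarily, the node has a leading `1`, and its vector is a vector with entries in `G` divided
by a nonzero element of `G`. -/
def Tame (G : Set ℂ) : {n : ℕ} → Node n → Prop
  | _, .leaf => True
  | _, .node A v B w =>
      (A = LIM.scalar _ 1 ∨ (A.coeff = 0 ∧ B = LIM.scalar _ 1)) ∧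
        (∃ g ∈ G, g ≠ 0 ∧ ∀ x, g * (Node.node A v B w).vec x ∈ G) ∧ Tame G v ∧ Tame G w

section Tame

variable {G U : Set ℂ}

theorem Tame.monic : {n : ℕ} → {v : Node n} → Tame G v → Monic v
  | _, .leaf, _ => ⟨fun _ => false, rfl⟩
  | _, .node _ _ _ _, h => by
    obtain ⟨h1, _, hv, hw⟩ := h
    rcases h1 with h1 | h1
    · exact h1 ▸ hv.monic.of_low _ _
    · exact h1.2 ▸ hw.monic.of_high _ _

theorem Tame.exists_scale (h1 : (1 : ℂ) ∈ G) :
    {n : ℕ} → {v : Node n} → Tame G v → ∃ g ∈ G, g ≠ 0 ∧ ∀ x, g * v.vec x ∈ G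
  | _, .leaf, _ => ⟨1, h1, one_ne_zero, fun _ => by simpa [Node.vec] using h1⟩
  | _, .node _ _ _ _, h => h.2.1

theorem Tame.child {n : ℕ} : {v : Node (n + 1)} → Tame G v → ∀ b, Tame G (v.child b).node
  | .node _ _ _ _, h, false => h.2.2.1
  | .node _ _ _ _, h, true => h.2.2.2

theorem Tame.child_vec {n : ℕ} {v : Node (n + 1)} {g : ℂ} (hg : ∀ x, g * v.vec x ∈ G) (b : Bool)
    (x : Fin n → Bool) : g * (v.child b).vec x ∈ G := by
  rw [← Node.top_vec]
  exact hg _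

theorem Tame.vec_mem (h1 : (1 : ℂ) ∈ G) (hGU : ∀ g ∈ G, ∀ h ∈ G, h / g ∈ U) {n : ℕ} {v : Node n}
    (hv : Tame G v) (x : Fin n → Bool) : v.vec x ∈ U := by
  obtain ⟨g, hg, hg0, h⟩ := hv.exists_scale h1
  have := hGU g hg _ (h x)
  rwa [mul_div_cancel_left₀ _ hg0] at this

theorem LIM.act_append {n m : ℕ} (A : LIM (n + m)) (ψ : QState (n + m)) (x : Fin m → Bool)
    (y : Fin n → Bool) :
    A.act ψ (Fin.append y x) =
      (⟨A.coeff * ∏ j, (A.pauli (Fin.natAdd n j)).entry (x j),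
        fun i => A.pauli (Fin.castAdd m i)⟩ : LIM n).act
        (fun y => ψ (Fin.append y fun j => xor (x j) (A.pauli (Fin.natAdd n j)).flip)) y := by
  have h : (fun i => xor (Fin.append y x i) (A.pauli i).flip) =
      Fin.append (fun i => xor (y i) (A.pauli (Fin.castAdd m i)).flip)
        (fun j => xor (x j) (A.pauli (Fin.natAdd n j)).flip) := by
    funext i
    refine Fin.addCases (fun i => ?_) (fun i => ?_) i <;> simp
  simp only [LIM.act, Fin.prod_univ_add, Fin.append_left, Fin.append_right]
  rw [h]
  ring

theorem vec_append_succ {n m : ℕ} (v : Node (n + m + 1)) (x : Fin (m + 1) → Bool)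
    (y : Fin n → Bool) :
    v.vec (Fin.append y x : Fin (n + (m + 1)) → Bool) =
      (v.child (x (Fin.last m))).vec (Fin.append y (Fin.init x)) := by
  rw [← Node.top_vec]
  refine congrArg v.vec ?_
  funext i
  refine Fin.lastCases ?_ (fun i => ?_) i
  · refine Eq.trans ?_ (Fin.snoc_last (n := n + m) (α := fun _ => Bool) _ _).symm
    exact Fin.append_right y x (Fin.last m)
  · rw [Fin.snoc_castSucc]
    refine Fin.addCases (fun i => ?_) (fun i => ?_) i
    · rw [Fin.append_left]
      exact Fin.append_left y x i
    · rw [Fin.append_right]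
      exact Fin.append_right y x i.castSucc

theorem follow_succ {n m : ℕ} (e : Edge (n + (m + 1))) (x : Fin (m + 1) → Bool) :
    follow n (m + 1) e x = (do
      let γ : ℂ := e.label.coeff * ∏ j, (e.label.pauli (Fin.natAdd n j)).entry (x j)
      emit {e.label.coeff, γ}
      let f ← follow n m
        (Node.child (n := n + m) e.node
          (xor (x (Fin.last m)) (e.label.pauli (Fin.natAdd n (Fin.last m))).flip))
        (Fin.init fun j => xor (x j) (e.label.pauli (Fin.natAdd n j)).flip)
      mulEdge ⟨γ, fun i => e.label.pauli (Fin.castAdd (m + 1) i)⟩ f) := rfl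

/-- A part of a vector has no new entries, so the returned label is bounded by the input vector and
not by the product of the labels on the path. For the recursive call the bound on the entries is
renewed from the tameness of the node. -/
theorem follow_spec (hU : PhaseClosed U) (h1 : (1 : ℂ) ∈ G)
    (hGU : ∀ g ∈ G, ∀ h ∈ G, h / g ∈ U) {n : ℕ} :
    ∀ (m : ℕ) (e : Edge (n + m)) (x : Fin m → Bool), Tame G e.node → e.label.coeff ∈ U →
      (∀ y, e.vec y ∈ U) →
      Tame G (follow n m e x).out.node ∧
        (follow n m e x).out.vec = (fun y => e.vec (Fin.append y x)) ∧ (follow n m e x).vals ⊆ U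
  | 0, e, x, he, hc, _ => by
    refine ⟨he, ?_, ?_⟩
    · funext y
      refine congrArg e.vec ?_
      funext i
      exact (Fin.append_left y x i).symm
    · simpa [follow] using hc
  | m + 1, e, x, he, hc, hv => by
    have hchild : ∀ b, (∀ y, (Node.child (n := n + m) e.node b).vec y ∈ U) := fun b y => by
      rw [← Node.top_vec]
      exact he.vec_mem h1 hGU _
    have hγ : e.label.coeff * ∏ j, (e.label.pauli (Fin.natAdd n j)).entry (x j) ∈ U := by
      rw [mul_comm]
      exact hU.mul_mem (LIM.prod_pow_four _ _ fun j => Pauli.entry_pow_four _ _) hc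
    -- The label of the result is a product and is at first left as a possible exception; once the
    -- represented vector is known, the label is read off it.
    have key : Tame G (follow n (m + 1) e x).out.node ∧
        (follow n (m + 1) e x).out.vec = (fun y => e.vec (Fin.append y x)) ∧
        (follow n (m + 1) e x).vals ⊆ U ∪ {(follow n (m + 1) e x).out.label.coeff} := by
      rw [follow_succ]
      set b := xor (x (Fin.last m)) (e.label.pauli (Fin.natAdd n (Fin.last m))).flip with hb
      obtain ⟨i1, i2, i3⟩ := follow_spec hU h1 hGU m (Node.child (n := n + m) e.node b)
        (Fin.init fun j => xor (x j) (e.label.pauli (Fin.natAdd n j)).flip)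
        (Tame.child (n := n + m) he b)
        ((Tame.child (n := n + m) he b).monic.coeff_mem' hU (hchild _)) (hchild _)
      simp only [out_bind, vals_bind, vals_emit, vals_mulEdge]
      refine ⟨i1, ?_, ?_⟩
      · refine (vec_mulEdge _ _).trans ?_
        rw [i2]
        funext y
        refine Eq.trans ?_ (LIM.act_append e.label e.node.vec x y).symm
        refine congrFun (congrArg _ ?_) y
        funext y
        exact (vec_append_succ (n := n) (m := m) e.node
          (fun j => xor (x j) (e.label.pauli (Fin.natAdd n j)).flip) y).symm
      · refine Set.union_subset ?_
          (Set.union_subset (i3.trans Set.subset_union_left) Set.subset_union_right)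
        exact (Set.insert_subset hc (Set.singleton_subset_iff.2 hγ)).trans Set.subset_union_left
    obtain ⟨k1, k2, k3⟩ := key
    refine ⟨k1, k2, fun z hz => ?_⟩
    rcases k3 hz with h | h
    · exact h
    · rw [Set.mem_singleton_iff.1 h]
      exact k1.monic.coeff_mem' hU fun y => by
        rw [k2]
        exact hv _

theorem follow_one_spec (hU : PhaseClosed U) (h1 : (1 : ℂ) ∈ G)
    (hGU : ∀ g ∈ G, ∀ h ∈ G, h / g ∈ U) {n : ℕ} {e : Edge (n + 1)} (he : Tame G e.node)
    (hc : e.label.coeff ∈ U) (hv : ∀ y, e.vec y ∈ U) (b : Bool) :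
    Tame G (follow n 1 e fun _ => b).out.node ∧ (follow n 1 e fun _ => b).out.vec = top b e.vec ∧
      (follow n 1 e fun _ => b).vals ⊆ U := by
  obtain ⟨i1, i2, i3⟩ := follow_spec hU h1 hGU 1 e (fun _ => b) he hc hv
  refine ⟨i1, i2.trans ?_, i3⟩
  funext y
  refine congrArg e.vec ?_
  funext i
  refine Fin.lastCases ?_ (fun i => ?_) i
  · rw [Fin.snoc_last]
    exact Fin.append_right y (fun _ : Fin 1 => b) 0
  · rw [Fin.snoc_castSucc]
    exact Fin.append_left y (fun _ : Fin 1 => b) i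

end Tame

/-! ## `GetLabels` and `MakeEdge` -/

theorem cand_coeff_mem {n : ℕ} {Q : Set ℂ} (hQ : PhaseClosed Q) {g₀ L g₁ : LIM n}
    (h₀ : g₀.coeff ^ 4 = 1) (h₁ : g₁.coeff ^ 4 = 1) (hL : L.coeff ∈ Q) :
    ((g₀.mul L).mul g₁).coeff ∈ Q := by
  obtain ⟨u, hu, h⟩ := LIM.mul_coeff (g₀.mul L) g₁
  obtain ⟨w, hw, h'⟩ := LIM.mul_coeff g₀ L
  have : ((g₀.mul L).mul g₁).coeff = (u * w * g₀.coeff * g₁.coeff) * L.coeff := by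
    rw [h, h']
    ring
  rw [this]
  refine hQ.mul_mem ?_ hL
  simp [mul_pow, *]

/-- The root label undoes each change of the high label: `g₀⁻¹` cancels `g₀` and fixes `|v₀⟩`, `Z`
cancels the sign, and `X ⊗ λP` exchanges the two halves, turning `λ⁻¹P` back into `λP`. The exchange
needs `v₀ = v₁`. -/
theorem labels_act {n : ℕ} {g₀ g₁ L : LIM n} {v₀ v₁ : Node n}
    (h₀ : g₀ ∈ automorphisms .limdd v₀) (h₁ : g₁ ∈ automorphisms .limdd v₁) (hL : L.coeff ≠ 0)
    (x s : Bool) (hx : v₀ = v₁ ∨ x = false) :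
    ((if x then L.tensor Pauli.X else LIM.scalar (n + 1) 1).mul
        (LIM.tensor (if s then Pauli.Z else Pauli.I) g₀.inv)).act
      (join v₀.vec ((LIM.smul (if s then -1 else 1)
        ((g₀.mul ⟨if x then L.coeff⁻¹ else L.coeff, L.pauli⟩).mul g₁)).act v₁.vec)) =
      join v₀.vec (L.act v₁.vec) := by
  have hi : g₀.inv.act v₀.vec = v₀.vec := by
    conv_lhs => rw [← h₀.2.2]
    exact LIM.inv_act_act h₀.1 _
  set M : LIM n := ⟨if x then L.coeff⁻¹ else L.coeff, L.pauli⟩ with hM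
  have hr : (LIM.tensor (if s then Pauli.Z else Pauli.I) g₀.inv).act
      (join v₀.vec ((LIM.smul (if s then -1 else 1) ((g₀.mul M).mul g₁)).act v₁.vec)) =
      join v₀.vec (M.act v₁.vec) := by
    rw [LIM.smul_act, LIM.mul_act, h₁.2.2, LIM.mul_act]
    cases s
    · simp only [Bool.false_eq_true, if_false, one_mul]
      rw [LIM.tensor_I_act_join, LIM.inv_act_act h₀.1, hi]
    · simp only [if_true]
      rw [LIM.tensor_Z_act_join, LIM.act_smul, LIM.inv_act_act h₀.1, hi]
      congr 1
      funext y
      ring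
  rw [LIM.mul_act, hr]
  cases x
  · simp [LIM.scalar_one_act, hM]
  · obtain rfl : v₀ = v₁ := by simpa using hx
    simp only [if_true]
    rw [LIM.tensor_X_act_join]
    congr 1
    refine (LIM.mk_act_mk_act L.coeff L.coeff⁻¹ L.pauli v₀.vec).trans ?_
    simp [mul_inv_cancel₀ hL]

theorem getLabels_spec (O : Orders) (K : Kind) {n : ℕ} {Q : Set ℂ} (hQ : PhaseClosed Q)
    (hQ1 : (1 : ℂ) ∈ Q) {L : LIM n} {v₀ v₁ : Node n} (h₀ : Monic v₀) (h₁ : Monic v₁)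
    (hL0 : L.coeff ≠ 0) (hL : L.coeff ∈ Q) (hL' : L.coeff⁻¹ ∈ Q) :
    (getLabels O K L v₀ v₁).vals ⊆ Q ∧
      (getLabels O K L v₀ v₁).out.2.act
        (join v₀.vec ((getLabels O K L v₀ v₁).out.1.act v₁.vec)) =
        join v₀.vec (L.act v₁.vec) := by
  cases K with
  | evdd =>
    refine ⟨?_, ?_⟩
    · simp [getLabels, LIM.scalar, Set.subset_def, hL, hQ1]
    · simp [getLabels, LIM.scalar_one_act]
  | limdd =>
    simp only [getLabels, vals_bind, vals_emit, vals_compute, vals_pure, out_bind, out_compute,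
      out_pure]
    generalize hg : argMin (O.lim n).le (fun g : LIM n × LIM n => (g.1.mul L).mul g.2)
      (automorphisms .limdd v₀ ×ˢ automorphisms .limdd v₁) (LIM.scalar n 1, LIM.scalar n 1) = g
    -- The default value of `argMin` is itself a pair of automorphisms, so it does not matter
    -- whether a minimum exists.
    have hgm : g ∈ automorphisms .limdd v₀ ×ˢ automorphisms .limdd v₁ :=
      hg ▸ argMin_mem _ _ ⟨one_mem_automorphisms _ _, one_mem_automorphisms _ _⟩
    clear hg
    obtain ⟨g₀, g₁⟩ := g
    obtain ⟨hg₀, hg₁⟩ : g₀ ∈ automorphisms .limdd v₀ ∧ g₁ ∈ automorphisms .limdd v₁ := hgm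
    have hc₀ := h₀.coeff_automorphism hg₀
    have hc₁ := h₁.coeff_automorphism hg₁
    have hcm : ∀ t : Bool × Bool, (LIM.smul (if t.2 then -1 else 1)
          ((g₀.mul ⟨if t.1 then L.coeff⁻¹ else L.coeff, L.pauli⟩).mul g₁)).coeff ∈ Q := by
      rintro ⟨x, s⟩
      have : (LIM.mk (if x then L.coeff⁻¹ else L.coeff) L.pauli).coeff ∈ Q := by
        cases x <;> simpa
      refine hQ.mul_mem ?_ (cand_coeff_mem hQ hc₀ hc₁ this)
      cases s <;> norm_num
    generalize ht : argMin (O.lim n).le _ _ (false, false) = t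
    have htm : v₀ = v₁ ∨ t.1 = false := by
      rw [← ht]
      by_cases h : v₀ = v₁
      · exact Or.inl h
      · right
        simp only [h, if_false]
        refine argMin_mem (S := {t : Bool × Bool | t.1 = false}) _ _ ?_
        rfl
    clear ht
    obtain ⟨x, s⟩ := t
    refine ⟨?_, labels_act hg₀ hg₁ hL0 x s htm⟩
    have hl : (if x then L.tensor Pauli.X else LIM.scalar (n + 1) 1).coeff ∈ Q := by
      cases x
      · exact hQ1
      · exact hL
    have hi : (LIM.tensor (if s then Pauli.Z else Pauli.I) g₀.inv).coeff ^ 4 = 1 := by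
      simp [LIM.tensor, LIM.inv, hc₀]
    rintro z (⟨k₀, hk₀, k₁, hk₁, rfl | rfl | rfl⟩ | ⟨t, -, rfl⟩ | rfl | rfl | rfl | rfl | hz)
    · exact hQ.mem_of_pow_four hQ1 (h₀.coeff_automorphism hk₀)
    · exact hQ.mem_of_pow_four hQ1 (h₁.coeff_automorphism hk₁)
    · exact cand_coeff_mem hQ (h₀.coeff_automorphism hk₀) (h₁.coeff_automorphism hk₁) hL
    · exact hcm t
    · exact hcm (x, s)
    · exact hl
    · exact hQ.mem_of_pow_four hQ1 hi
    · obtain ⟨u, hu, h⟩ := LIM.mul_coeff (if x then L.tensor Pauli.X else LIM.scalar (n + 1) 1)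
        (LIM.tensor (if s then Pauli.Z else Pauli.I) g₀.inv)
      rw [h, mul_comm (LIM.coeff _), ← mul_assoc]
      refine hQ.mul_mem ?_ hl
      rw [mul_pow, hu, hi, one_mul]
    · exact hz.elim

section MakeEdge

variable {U : Set ℂ}

/-- Pointwise products, quotients and sums of sets count the arithmetic operations behind a number.
The basic set is closed only under powers of `i`, so each further operation enlarges the set. -/
theorem PhaseClosed.mul_left {V : Set ℂ} (hU : PhaseClosed U) : PhaseClosed (U * V) := by
  rintro _ ⟨a, ha, b, hb, rfl⟩
  exact ⟨_, hU a ha, b, hb, mul_assoc _ _ _⟩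

theorem PhaseClosed.div {V : Set ℂ} (hU : PhaseClosed U) : PhaseClosed (U / V) := by
  rintro _ ⟨a, ha, b, hb, rfl⟩
  exact ⟨_, hU a ha, b, hb, mul_div_assoc _ _ _⟩

theorem PhaseClosed.add {V : Set ℂ} (hU : PhaseClosed U) (hV : PhaseClosed V) :
    PhaseClosed (U + V) := by
  rintro _ ⟨a, ha, b, hb, rfl⟩
  exact ⟨_, hU a ha, _, hV b hb, (mul_add _ _ _).symm⟩

theorem subset_div_self (h1 : (1 : ℂ) ∈ U) : U ⊆ U / U := fun z hz => ⟨z, hz, 1, h1, div_one z⟩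

theorem makeEdgeOrdered_spec (O : Orders) (K : Kind) {n : ℕ} (hU : PhaseClosed U)
    (h0 : (0 : ℂ) ∈ U) (h1 : (1 : ℂ) ∈ U) {e₀ e₁ : Edge n} (m₀ : Monic e₀.node)
    (m₁ : Monic e₁.node) (v₀ : ∀ x, e₀.vec x ∈ U) (v₁ : ∀ x, e₁.vec x ∈ U)
    (hc : e₀.label.coeff ≠ 0) :
    (makeEdgeOrdered O K e₀ e₁).out.vec = join e₀.vec e₁.vec ∧
      Monic (makeEdgeOrdered O K e₀ e₁).out.node ∧
      (makeEdgeOrdered O K e₀ e₁).vals ⊆ U / U := by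
  have c₀ := m₀.coeff_mem' hU v₀
  have c₁ := m₁.coeff_mem' hU v₁
  have hD : PhaseClosed (U / U) := hU.div
  have hs := subset_div_self h1
  unfold makeEdgeOrdered
  split_ifs with hz
  · refine ⟨?_, m₀.of_low _ _, ?_⟩
    · simp only [out_bind, out_compute, out_pure, Edge.vec]
      rw [Node.vec_eq_join, LIM.tensor_I_act_join, LIM.act_of_coeff_eq_zero hz,
        show (Node.node (LIM.scalar n 1) e₀.node (LIM.scalar n 0) e₀.node).low.vec =
          e₀.node.vec from LIM.scalar_one_act _,
        show (Node.node (LIM.scalar n 1) e₀.node (LIM.scalar n 0) e₀.node).high.vec =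
          fun _ => 0 from LIM.act_of_coeff_eq_zero rfl _]
      rw [LIM.act_zero]
    · rintro z (rfl | (rfl | rfl) | h)
      · exact hs c₀
      · exact hs h0
      · exact hs h1
      · exact h.elim
  · obtain ⟨u, hu, hL⟩ := LIM.mul_coeff e₀.label.inv e₁.label
    have hL' : (e₀.label.inv.mul e₁.label).coeff = u * (e₁.label.coeff / e₀.label.coeff) := by
      rw [hL, LIM.inv]
      ring
    have hu0 : u ≠ 0 := by
      rintro rfl
      norm_num at hu
    obtain ⟨g1, g2⟩ := getLabels_spec O K hD (hs h1) (L := e₀.label.inv.mul e₁.label) m₀ m₁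
      (by
        rw [hL']
        exact mul_ne_zero hu0 (div_ne_zero hz hc))
      (by
        rw [hL']
        exact hD.mul_mem hu ⟨_, c₁, _, c₀, rfl⟩)
      (by
        rw [hL', mul_inv, inv_div]
        exact hD.mul_mem (by rw [inv_pow, hu, inv_one]) ⟨_, c₀, _, c₁, rfl⟩)
    simp only [out_bind, out_compute, out_pure, vals_bind, vals_compute, vals_emit, vals_pure]
    generalize hr : getLabels O K (e₀.label.inv.mul e₁.label) e₀.node e₁.node = r at g1 g2 ⊢
    have hm : Monic (Node.node (LIM.scalar n 1) e₀.node r.out.1 e₁.node) := m₀.of_low _ _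
    have hv : (Edge.mk ((e₀.label.tensor Pauli.I).mul r.out.2)
        (Node.node (LIM.scalar n 1) e₀.node r.out.1 e₁.node)).vec = join e₀.vec e₁.vec := by
      rw [Edge.vec, LIM.mul_act, Node.vec_eq_join]
      have : (Node.node (LIM.scalar n 1) e₀.node r.out.1 e₁.node).low.vec = e₀.node.vec :=
        LIM.scalar_one_act _
      rw [this]
      refine (congrArg _ g2).trans ?_
      rw [LIM.tensor_I_act_join, LIM.mul_act, LIM.act_inv_act hc]
      rfl
    -- As a product with the output of `getLabels` the root label would only lie in a larger set;
    -- the represented vector places it in `U`.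
    have hroot : ((e₀.label.tensor Pauli.I).mul r.out.2).coeff ∈ U :=
      Monic.coeff_mem' (e := ⟨(e₀.label.tensor Pauli.I).mul r.out.2, _⟩) hm hU fun x => by
        rw [hv]
        exact forall_join v₀ v₁ x
    refine ⟨hv, hm, ?_⟩
    rintro z (rfl | rfl | h | rfl | rfl | h)
    · exact ⟨1, h1, _, c₀, one_div _⟩
    · rw [hL']
      exact hD.mul_mem hu ⟨_, c₁, _, c₀, rfl⟩
    · exact g1 h
    · exact hs hroot
    · exact hs h1
    · exact h.elim

theorem makeEdge_spec (O : Orders) (K : Kind) {n : ℕ} (hU : PhaseClosed U)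
    (h0 : (0 : ℂ) ∈ U) (h1 : (1 : ℂ) ∈ U) {e₀ e₁ : Edge n} (m₀ : Monic e₀.node)
    (m₁ : Monic e₁.node) (v₀ : ∀ x, e₀.vec x ∈ U) (v₁ : ∀ x, e₁.vec x ∈ U) :
    (makeEdge O K e₀ e₁).out.vec = join e₀.vec e₁.vec ∧
      Monic (makeEdge O K e₀ e₁).out.node ∧ (makeEdge O K e₀ e₁).vals ⊆ U / U := by
  have c₀ := m₀.coeff_mem' hU v₀
  have c₁ := m₁.coeff_mem' hU v₁
  have hs := subset_div_self h1
  have hemit : ({e₀.label.coeff, e₁.label.coeff} : Set ℂ) ⊆ U / U := by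
    rintro z (rfl | rfl)
    · exact hs c₀
    · exact hs c₁
  have h01 : ({0, 1} : Set ℂ) ⊆ U / U := by
    rintro z (rfl | rfl)
    · exact hs h0
    · exact hs h1
  unfold makeEdge
  rw [vals_bind, out_bind, Set.union_subset_iff]
  have hemit' : (emit {e₀.label.coeff, e₁.label.coeff}).vals ⊆ U / U := hemit
  simp only [hemit', true_and]
  by_cases hz : e₀.label.coeff = 0 ∧ e₁.label.coeff = 0
  · rw [if_pos hz]
    refine ⟨?_, m₀.of_low _ _, ?_⟩
    · simp only [out_bind, out_pure, Edge.vec]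
      rw [LIM.act_of_coeff_eq_zero rfl, LIM.act_of_coeff_eq_zero hz.1,
        LIM.act_of_coeff_eq_zero hz.2]
      funext x
      simp [join]
    · rintro z (h | h)
      · exact h01 h
      · exact h.elim
  · rw [if_neg hz]
    cases K with
    | evdd =>
      simp only
      split_ifs with hz₀
      · refine ⟨?_, m₁.of_high _ _, ?_⟩
        · simp only [out_bind, out_compute, out_pure, Edge.vec]
          rw [Node.vec_eq_join, LIM.tensor_I_act_join, LIM.act_of_coeff_eq_zero hz₀,
            show (Node.node (LIM.scalar n 0) e₁.node (LIM.scalar n 1) e₁.node).low.vec =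
              fun _ => 0 from LIM.act_of_coeff_eq_zero rfl _,
            show (Node.node (LIM.scalar n 0) e₁.node (LIM.scalar n 1) e₁.node).high.vec =
              e₁.node.vec from LIM.scalar_one_act _]
          rw [LIM.act_zero]
        · rintro z (rfl | h | h)
          · exact hs c₁
          · exact h01 h
          · exact h.elim
      · exact makeEdgeOrdered_spec O _ hU h0 h1 m₀ m₁ v₀ v₁ hz₀
    | limdd =>
      simp only
      split_ifs with hsw
      · have hc : e₁.label.coeff ≠ 0 := by
          rcases hsw with h | h
          · exact fun h' => hz ⟨h, h'⟩
          · exact h.1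
        obtain ⟨i1, i2, i3⟩ := makeEdgeOrdered_spec O .limdd hU h0 h1 m₁ m₀ v₁ v₀ hc
        rw [out_bind, vals_bind, vec_mulEdge, i1, LIM.tensor_X_act_join, LIM.scalar_one_act,
          LIM.scalar_one_act, vals_mulEdge]
        refine ⟨rfl, i2, Set.union_subset i3 ?_⟩
        rintro z rfl
        obtain ⟨u, hu, h⟩ := LIM.mul_coeff ((LIM.scalar n 1).tensor Pauli.X)
          (makeEdgeOrdered O .limdd e₁ e₀).out.label
        rw [h, show ((LIM.scalar n 1).tensor Pauli.X).coeff = 1 from rfl, one_mul]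
        refine hs (hU.mul_mem hu (i2.coeff_mem' hU fun x => ?_))
        rw [i1]
        exact forall_join v₁ v₀ x
      · push Not at hsw
        exact makeEdgeOrdered_spec O _ hU h0 h1 m₀ m₁ v₀ v₁ hsw.1

end MakeEdge

/-! ## `Add` -/

section Add

variable {G E : Set ℂ}

theorem rootLabel_spec (O : Orders) (K : Kind) {n : ℕ} {Q : Set ℂ} (hQ : PhaseClosed Q)
    (h1 : (1 : ℂ) ∈ Q) {e : Edge n} (m : Monic e.node) (hc : e.label.coeff ∈ Q) :
    (rootLabel O K e).vals ⊆ Q ∧ (rootLabel O K e).out.coeff ∈ Q ∧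
      (rootLabel O K e).out.act e.node.vec = e.vec := by
  have key : ∀ g ∈ automorphisms K e.node, (e.label.mul g).coeff ∈ Q := fun g hg => by
    obtain ⟨u, hu, h⟩ := LIM.mul_coeff e.label g
    rw [h, mul_comm e.label.coeff, ← mul_assoc]
    refine hQ.mul_mem ?_ hc
    rw [mul_pow, hu, m.coeff_automorphism hg, one_mul]
  simp only [rootLabel, out_bind, vals_bind, vals_emit, vals_compute, out_compute]
  generalize hg : argMin (O.lim n).le (fun g => e.label.mul g) (automorphisms K e.node)
    (LIM.scalar n 1) = g
  have hgm : g ∈ automorphisms K e.node := hg ▸ argMin_mem _ _ (one_mem_automorphisms _ _)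
  refine ⟨?_, key g hgm, ?_⟩
  · rintro z (⟨k, hk, rfl | rfl⟩ | rfl)
    · exact hQ.mem_of_pow_four h1 (m.coeff_automorphism hk)
    · exact key k hk
    · exact key g hgm
  · rw [LIM.mul_act, hgm.2.2]
    rfl

/-- `Add` on two edges with nonzero labels that are in the right order. -/
def addOrdered (O : Orders) (K : Kind) (n : ℕ) (e f : Edge (n + 1)) : Run (Edge (n + 1)) := do
  let Ai ← compute e.label.inv
  let AiB ← compute (Ai.mul f.label)
  let C ← rootLabel O K ⟨AiB, f.node⟩
  let v₀ ← follow n 1 ⟨LIM.scalar (n + 1) 1, e.node⟩ (fun _ => false)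
  let w₀ ← follow n 1 ⟨C, f.node⟩ (fun _ => false)
  let a₀ ← add O K n v₀ w₀
  let v₁ ← follow n 1 ⟨LIM.scalar (n + 1) 1, e.node⟩ (fun _ => true)
  let w₁ ← follow n 1 ⟨C, f.node⟩ (fun _ => true)
  let a₁ ← add O K n v₁ w₁
  let a ← makeEdge O K a₀ a₁
  mulEdge e.label a

theorem add_zero_level (O : Orders) (K : Kind) (e f : Edge 0) :
    add O K 0 e f = (emit {e.label.coeff, f.label.coeff} >>= fun _ =>
      compute (LIM.scalar 0 (e.label.coeff + f.label.coeff)) >>= fun C => pure ⟨C, .leaf⟩) := rfl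

open Classical in
theorem add_succ (O : Orders) (K : Kind) (n : ℕ) (e f : Edge (n + 1)) :
    add O K (n + 1) e f = (emit {e.label.coeff, f.label.coeff} >>= fun _ =>
      if e.label.coeff = 0 then pure f
      else if f.label.coeff = 0 then pure e
      else addOrdered O K n (if (O.node (n + 1)).le e.node f.node then e else f)
        (if (O.node (n + 1)).le e.node f.node then f else e)) := rfl

/-- A common denominator makes the sum cost one addition and one division. -/
theorem add_mem_add_div {ν a b : ℂ} (hν : ν ∈ E) (h0 : ν ≠ 0) (ha : ν * a ∈ E)
    (hb : ν * b ∈ E) : a + b ∈ (E + E) / E := by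
  refine ⟨ν * a + ν * b, ⟨_, ha, _, hb, rfl⟩, ν, hν, ?_⟩
  change (ν * a + ν * b) / ν = a + b
  field_simp

theorem div_subset_add_div (h0 : (0 : ℂ) ∈ E) : E / E ⊆ (E + E) / E :=
  Set.div_subset_div_right fun z hz => ⟨z, hz, 0, h0, add_zero z⟩

/-- The call `Add(e, f)` returns an edge for the sum, and computes only numbers in `Q`. -/
def AddSound (O : Orders) (K : Kind) (Q : Set ℂ) {n : ℕ} (e f : Edge n) : Prop :=
  (add O K n e f).out.vec = (fun x => e.vec x + f.vec x) ∧
    Monic (add O K n e f).out.node ∧ (add O K n e f).vals ⊆ Q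

/-- A common multiple of the vectors of the two edges, by an element of `E`, has entries in `E`. -/
def CommonScale (E : Set ℂ) {n : ℕ} (e f : Edge n) : Prop :=
  ∃ ν ∈ E, ν ≠ 0 ∧ (∀ x, ν * e.vec x ∈ E) ∧ ∀ x, ν * f.vec x ∈ E

theorem CommonScale.symm {n : ℕ} {e f : Edge n} (h : CommonScale E e f) : CommonScale E f e := by
  obtain ⟨ν, h1, h2, h3, h4⟩ := h
  exact ⟨ν, h1, h2, h4, h3⟩

/-- Factoring out the label `A` with coefficient `a` replaces the common scale `ν` by `ν * a`, which
is again in `E`: up to a power of `i` it is an entry of `ν` times the vector of `e`. The rescaled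
vectors have, up to powers of `i`, the same entries as before. Thus the recursive calls satisfy the
hypothesis with the same `E`, and the bound does not depend on the depth. -/
theorem addOrdered_spec (O : Orders) (K : Kind) (hG1 : (1 : ℂ) ∈ G) (hE : PhaseClosed E)
    (h0 : (0 : ℂ) ∈ E) (h1 : (1 : ℂ) ∈ E) (hGE : ∀ g ∈ G, ∀ h ∈ G, h / g ∈ E / E) {n : ℕ}
    (ih : ∀ e f : Edge n, Tame G e.node → Tame G f.node → CommonScale E e f →
      AddSound O K (((E + E) / E) / ((E + E) / E)) e f)
    {e f : Edge (n + 1)} (he : Tame G e.node) (hf : Tame G f.node) (hs : CommonScale E e f)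
    (hce : e.label.coeff ≠ 0) :
    (addOrdered O K n e f).out.vec = (fun x => e.vec x + f.vec x) ∧
      Monic (addOrdered O K n e f).out.node ∧
      (addOrdered O K n e f).vals ⊆ ((E + E) / E) / ((E + E) / E) := by
  obtain ⟨ν, hν, hν0, hve, hvf⟩ := hs
  have hU : PhaseClosed ((E + E) / E) := (hE.add hE).div
  have hD : PhaseClosed (E / E) := hE.div
  have hDU := div_subset_add_div h0
  have hU1 : (1 : ℂ) ∈ (E + E) / E := hDU (subset_div_self h1 h1)
  have hU0 : (0 : ℂ) ∈ (E + E) / E := hDU (subset_div_self h1 h0)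
  have hUU := subset_div_self hU1
  have hDQ : E / E ⊆ ((E + E) / E) / ((E + E) / E) := hDU.trans hUU
  have ce : ν * e.label.coeff ∈ E := he.monic.coeff_mem hE hve
  have cf : ν * f.label.coeff ∈ E := hf.monic.coeff_mem hE hvf
  have hc0 : ν * e.label.coeff ≠ 0 := mul_ne_zero hν0 hce
  have hAi : e.label.inv.coeff ∈ E / E := ⟨ν, hν, _, ce, by
    change ν / (ν * e.label.coeff) = e.label.coeff⁻¹
    field_simp⟩
  have hAiB : (e.label.inv.mul f.label).coeff ∈ E / E := by
    obtain ⟨u, hu, h⟩ := LIM.mul_coeff e.label.inv f.label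
    rw [h]
    refine hD.mul_mem hu ⟨_, cf, _, ce, ?_⟩
    change ν * f.label.coeff / (ν * e.label.coeff) = e.label.coeff⁻¹ * f.label.coeff
    field_simp
  obtain ⟨r1, r2, r3⟩ := rootLabel_spec O K hD (subset_div_self h1 h1)
    (e := ⟨e.label.inv.mul f.label, f.node⟩) hf.monic hAiB
  replace r3 : (rootLabel O K ⟨e.label.inv.mul f.label, f.node⟩).out.act f.node.vec =
      e.label.inv.act f.vec := r3.trans (LIM.mul_act _ _ _)
  simp only [addOrdered, out_bind, vals_bind, vals_compute, out_compute]
  generalize (rootLabel O K ⟨e.label.inv.mul f.label, f.node⟩).out = C at r2 r3 ⊢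
  have sv : ∀ x, ν * e.label.coeff * e.node.vec x ∈ E := fun x => by
    obtain ⟨u, hu, y, hy⟩ := LIM.exists_eq_act e.label e.node.vec x
    refine hE.mem_of_mul_mem hu ?_
    have := hve y
    rw [Edge.vec, hy] at this
    convert this using 1
    ring
  have sw : ∀ x, ν * e.label.coeff * e.label.inv.act f.vec x ∈ E := fun x => by
    obtain ⟨u, hu, y, hy⟩ := LIM.exists_act_eq e.label.inv f.vec x
    rw [hy]
    convert hE.mul_mem hu (hvf y) using 1
    simp only [LIM.inv]
    field_simp
  have dw : ∀ x, e.label.inv.act f.vec x ∈ E / E := fun x =>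
    ⟨_, sw x, _, ce, mul_div_cancel_left₀ _ hc0⟩
  have F : ∀ b, _ := fun b => follow_one_spec hD hG1 hGE
    (e := ⟨LIM.scalar (n + 1) 1, e.node⟩) he (subset_div_self h1 h1) (fun y => by
      rw [Edge.vec, LIM.scalar_one_act]
      exact he.vec_mem hG1 hGE y) b
  have F' : ∀ b, _ := fun b => follow_one_spec hD hG1 hGE (e := ⟨C, f.node⟩) hf r2 (fun y => by
      rw [Edge.vec, r3]
      exact dw y) b
  have hv1 : (Edge.mk (LIM.scalar (n + 1) 1) e.node).vec = e.node.vec := LIM.scalar_one_act _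
  have hv2 : (Edge.mk C f.node).vec = e.label.inv.act f.vec := r3
  rw [hv1] at F
  rw [hv2] at F'
  have A : ∀ b, _ := fun b => ih _ _ (F b).1 (F' b).1 ⟨_, ce, hc0,
    fun x => by
      rw [(F b).2.1]
      exact sv _,
    fun x => by
      rw [(F' b).2.1]
      exact sw _⟩
  have hsum : ∀ x, e.node.vec x + e.label.inv.act f.vec x ∈ (E + E) / E := fun x =>
    add_mem_add_div ce hc0 (sv x) (sw x)
  have Av : ∀ b, (add O K n (follow n 1 ⟨LIM.scalar (n + 1) 1, e.node⟩ fun _ => b).out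
      (follow n 1 ⟨C, f.node⟩ fun _ => b).out).out.vec =
      top b fun x => e.node.vec x + e.label.inv.act f.vec x := fun b => by
    rw [(A b).1, (F b).2.1, (F' b).2.1]
    rfl
  obtain ⟨k1, k2, k3⟩ := makeEdge_spec O K hU hU0 hU1 (A false).2.1 (A true).2.1
    (fun x => by
      rw [Av]
      exact hsum _)
    (fun x => by
      rw [Av]
      exact hsum _)
  rw [Av, Av, join_top] at k1
  have hvec : ∀ a : Edge (n + 1), a.vec = (fun x => e.node.vec x + e.label.inv.act f.vec x) →
      (mulEdge e.label a).out.vec = fun x => e.vec x + f.vec x := fun a ha => by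
    rw [vec_mulEdge, ha, LIM.act_add, LIM.act_inv_act hce]
    rfl
  have hv := hvec _ k1
  refine ⟨hv, k2, ?_⟩
  simp only [Set.union_subset_iff, Set.singleton_subset_iff]
  refine ⟨hDQ hAi, hDQ hAiB, r1.trans hDQ, (F false).2.2.trans hDQ, (F' false).2.2.trans hDQ,
    (A false).2.2, (F true).2.2.trans hDQ, (F' true).2.2.trans hDQ, (A true).2.2, k3, ?_⟩
  rw [vals_mulEdge, Set.singleton_subset_iff]
  refine hUU (Monic.coeff_mem' (e := (mulEdge e.label _).out) k2 hU fun x => ?_)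
  rw [hv]
  exact add_mem_add_div hν hν0 (hve x) (hvf x)

theorem add_spec (O : Orders) (K : Kind) (hG1 : (1 : ℂ) ∈ G) (hE : PhaseClosed E)
    (h0 : (0 : ℂ) ∈ E) (h1 : (1 : ℂ) ∈ E) (hGE : ∀ g ∈ G, ∀ h ∈ G, h / g ∈ E / E) :
    ∀ {n : ℕ} (e f : Edge n), Tame G e.node → Tame G f.node → CommonScale E e f →
      AddSound O K (((E + E) / E) / ((E + E) / E)) e f := by
  have hU : PhaseClosed ((E + E) / E) := (hE.add hE).div
  have hDU := div_subset_add_div h0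
  have hU1 : (1 : ℂ) ∈ (E + E) / E := hDU (subset_div_self h1 h1)
  have hUU := subset_div_self hU1
  have hDQ : E / E ⊆ ((E + E) / E) / ((E + E) / E) := hDU.trans hUU
  have hemit : ∀ {n : ℕ} (e f : Edge n), Tame G e.node → Tame G f.node → CommonScale E e f →
      ({e.label.coeff, f.label.coeff} : Set ℂ) ⊆ ((E + E) / E) / ((E + E) / E) := by
    rintro n e f he hf ⟨ν, hν, hν0, hve, hvf⟩ z (rfl | rfl)
    · exact hDQ ⟨_, he.monic.coeff_mem hE hve, ν, hν, mul_div_cancel_left₀ _ hν0⟩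
    · exact hDQ ⟨_, hf.monic.coeff_mem hE hvf, ν, hν, mul_div_cancel_left₀ _ hν0⟩
  intro n
  induction n with
  | zero =>
    intro e f he hf hs
    have hc : ∀ g : Edge 0, g.vec = fun _ => g.label.coeff := by
      rintro ⟨A, v⟩
      cases v
      funext x
      simp [Edge.vec, LIM.act, Node.vec]
    rw [AddSound, add_zero_level]
    refine ⟨?_, ⟨fun _ => false, rfl⟩, Set.union_subset (hemit e f he hf hs) ?_⟩
    · rw [hc e, hc f, hc]
      rfl
    · obtain ⟨ν, hν, hν0, hve, hvf⟩ := hs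
      rintro z (rfl | h)
      · exact hUU (add_mem_add_div hν hν0 (he.monic.coeff_mem hE hve)
          (hf.monic.coeff_mem hE hvf))
      · exact h.elim
  | succ n ih =>
    intro e f he hf hs
    have hem := hemit e f he hf hs
    rw [AddSound, add_succ, out_bind, vals_bind, vals_emit, Set.union_subset_iff]
    simp only [hem, true_and]
    split_ifs with hz hz' hle
    · refine ⟨?_, hf.monic, Set.empty_subset _⟩
      rw [out_pure, Edge.vec, Edge.vec, LIM.act_of_coeff_eq_zero hz]
      simp
    · refine ⟨?_, he.monic, Set.empty_subset _⟩
      rw [out_pure, Edge.vec, Edge.vec, LIM.act_of_coeff_eq_zero hz']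
      simp
    · exact addOrdered_spec O K hG1 hE h0 h1 hGE ih he hf hs hz
    · obtain ⟨i1, i2⟩ := addOrdered_spec O K hG1 hE h0 h1 hGE ih hf he hs.symm hz'
      refine ⟨i1.trans ?_, i2⟩
      funext x
      exact add_comm _ _

end Add

/-! ## The Hadamard gate -/

section Hadamard

variable {n : ℕ}

/-- Row `s` of the one-qubit identity `H p = ± (conjH p) H`, applied to the vector `(a, b)` and
multiplied by `√2`. -/
theorem Pauli.hadamard_entry (p : Pauli) (s : Bool) (a b : ℂ) :
    p.entry false * (if p.flip then b else a) +
        (if s then -1 else 1) * (p.entry true * (if p.flip then a else b)) =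
      (if p = Pauli.Y then -1 else 1) * p.conjH.entry s *
        (a + (if xor s p.conjH.flip then -1 else 1) * b) := by
  cases p <;> cases s <;> simp [Pauli.entry, Pauli.flip, Pauli.conjH] <;> ring

theorem LIM.act_update (A : LIM n) (ψ : QState n) (x : Fin n → Bool) (k : Fin n) (b : Bool) :
    A.act ψ (Function.update x k b) =
      A.coeff * (∏ i ∈ Finset.univ.erase k, (A.pauli i).entry (x i)) *
        ((A.pauli k).entry b * ψ (Function.update (fun i => xor (x i) (A.pauli i).flip) k
          (xor b (A.pauli k).flip))) := by
  have h : (fun i => xor (Function.update x k b i) (A.pauli i).flip) =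
      Function.update (fun i => xor (x i) (A.pauli i).flip) k (xor b (A.pauli k).flip) := by
    funext i
    by_cases hi : i = k
    · subst hi
      simp
    · simp [hi]
  have h' : ∏ i ∈ Finset.univ.erase k, (A.pauli i).entry (Function.update x k b i) =
      ∏ i ∈ Finset.univ.erase k, (A.pauli i).entry (x i) :=
    Finset.prod_congr rfl fun i hi => by
      rw [Function.update_of_ne (Finset.ne_of_mem_erase hi)]
  simp only [LIM.act]
  rw [h, ← Finset.mul_prod_erase _ _ (Finset.mem_univ k), h', Function.update_self]
  ring

theorem LIM.hadamard_act (A : LIM n) (k : Fin n) (ψ : QState n) :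
    (Gate.H k).apply (A.act ψ) = (A.conjH k).act ((Gate.H k).apply ψ) := by
  funext x
  set w : Fin n → Bool := fun i => xor (x i) (A.pauli i).flip with hw
  have hR := LIM.act_update (A.conjH k) ((Gate.H k).apply ψ) x k (x k)
  rw [Function.update_eq_self] at hR
  have hp : (A.conjH k).pauli k = (A.pauli k).conjH := by simp [LIM.conjH]
  have h1 : ∏ i ∈ Finset.univ.erase k, ((A.conjH k).pauli i).entry (x i) =
      ∏ i ∈ Finset.univ.erase k, (A.pauli i).entry (x i) :=
    Finset.prod_congr rfl fun i hi => by
      simp [LIM.conjH, Function.update_of_ne (Finset.ne_of_mem_erase hi)]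
  have h2 : ∀ b, Function.update (fun i => xor (x i) ((A.conjH k).pauli i).flip) k b =
      Function.update w k b := fun b => by
    funext i
    by_cases hi : i = k
    · subst hi
      simp
    · simp [hi, LIM.conjH, hw]
  rw [hR, h1, hp, h2]
  simp only [Gate.apply, Function.update_idem, Function.update_self]
  rw [LIM.act_update, LIM.act_update]
  have hc : (A.conjH k).coeff = (if A.pauli k = Pauli.Y then -1 else 1) * A.coeff := by
    simp only [LIM.conjH]
    split_ifs <;> simp
  have h3 : ∀ b, ψ (Function.update w k (xor b (A.pauli k).flip)) =
      if (A.pauli k).flip then ψ (Function.update w k (!b)) else ψ (Function.update w k b) := by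
    intro b
    cases (A.pauli k).flip <;> simp
  rw [hc, h3, h3, Bool.not_false, Bool.not_true]
  linear_combination (A.coeff * (∏ i ∈ Finset.univ.erase k, (A.pauli i).entry (x i)) /
    (Real.sqrt 2 : ℂ)) * Pauli.hadamard_entry (A.pauli k) (x k) (ψ (Function.update w k false))
      (ψ (Function.update w k true))

theorem hadamard_last (ψ : QState (n + 1)) :
    (Gate.H (Fin.last n)).apply ψ = fun x => (1 / (Real.sqrt 2 : ℂ)) *
      join (fun y => top false ψ y + top true ψ y)
        (fun y => top false ψ y + -1 * top true ψ y) x := by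
  funext x
  have h : ∀ b, ψ (Function.update x (Fin.last n) b) = top b ψ (Fin.init x) := fun b => by
    rw [top]
    congr 1
    funext i
    refine Fin.lastCases ?_ (fun i => ?_) i
    · simp
    · simp [Fin.init]
  simp only [Gate.apply, join, h]
  cases x (Fin.last n) <;> simp <;> ring

theorem hadamard_join {k : Fin (n + 1)} (hk : k ≠ Fin.last n) (ψ φ : QState n) :
    (Gate.H k).apply (join ψ φ) =
      join ((Gate.H (k.castPred hk)).apply ψ) ((Gate.H (k.castPred hk)).apply φ) := by
  obtain ⟨k, rfl⟩ := Fin.exists_castSucc_eq.2 hk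
  funext x
  have h : ∀ b, Fin.init (Function.update x k.castSucc b) = Function.update (Fin.init x) k b :=
    fun b => Fin.init_update_castSucc ..
  have h' : ∀ b, Function.update x k.castSucc b (Fin.last n) = x (Fin.last n) := fun b =>
    Function.update_of_ne (Fin.castSucc_lt_last k).ne' _ _
  simp only [Gate.apply, join, h, h', Fin.castPred_castSucc]
  cases x (Fin.last n) <;> rfl

end Hadamard

section HGate

variable {G : Set ℂ}

theorem run_bind_assoc {α β γ : Type} (r : Run α) (f : α → Run β) (g : β → Run γ) :
    (r >>= f) >>= g = r >>= fun a => f a >>= g :=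
  congrArg (Run.mk _) (Set.union_assoc _ _ _)

/-- The Hadamard gate on the node of an edge, given that it is computed by `c`. -/
def hGateFinish {n : ℕ} (e : Edge (n + 1)) (k : Fin (n + 1)) (c : Run (Edge (n + 1))) :
    Run (Edge (n + 1)) :=
  emit {e.label.coeff} >>= fun _ => c >>= fun c =>
    compute (e.label.conjH k) >>= fun B => mulEdge B c

theorem hGate_last (O : Orders) (K : Kind) (n : ℕ) (e : Edge (n + 1)) :
    hGate O K (n + 1) e (Fin.last n) = hGateFinish e (Fin.last n)
      (add O K n e.node.low e.node.high >>= fun a₀ =>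
        compute (e.node.high.label.smul (-1)) >>= fun M =>
          add O K n e.node.low ⟨M, e.node.high.node⟩ >>= fun a₁ =>
            makeEdge O K a₀ a₁ >>= fun a =>
              compute (LIM.scalar (n + 1) (1 / (Real.sqrt 2 : ℂ))) >>= fun s => mulEdge s a) := by
  rw [hGate, dif_pos rfl]
  simp only [hGateFinish, run_bind_assoc]

theorem hGate_of_ne (O : Orders) (K : Kind) (n : ℕ) (e : Edge (n + 1)) {k : Fin (n + 1)}
    (hk : k ≠ Fin.last n) :
    hGate O K (n + 1) e k = hGateFinish e k
      (hGate O K n e.node.low (k.castPred hk) >>= fun a₀ =>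
        hGate O K n e.node.high (k.castPred hk) >>= fun a₁ => makeEdge O K a₀ a₁) := by
  rw [hGate, dif_neg hk]
  simp only [hGateFinish, run_bind_assoc]

/-- Numerators `g * h` with `g, h ∈ G`, and all quotients of sums of two of them by such numbers and
possibly by `√2`. -/
def Amplitudes (G : Set ℂ) : Set ℂ :=
  ((G * G + G * G) / (G * G)) / ({1, (Real.sqrt 2 : ℂ)} : Set ℂ)

theorem sqrt_two_ne_zero : (Real.sqrt 2 : ℂ) ≠ 0 := by
  norm_num

theorem Amplitudes.phaseClosed (hG : PhaseClosed G) : PhaseClosed (Amplitudes G) :=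
  (hG.mul_left.add hG.mul_left).div.div

theorem subset_mul_self (h1 : (1 : ℂ) ∈ G) : G ⊆ G * G := fun z hz => ⟨z, hz, 1, h1, mul_one z⟩

theorem div_mem_mul_div (h1 : (1 : ℂ) ∈ G) : ∀ g ∈ G, ∀ h ∈ G, h / g ∈ (G * G) / (G * G) :=
  fun _ hg _ hh => Set.div_mem_div (subset_mul_self h1 hh) (subset_mul_self h1 hg)

theorem sum_subset_amplitudes : (G * G + G * G) / (G * G) ⊆ Amplitudes G := fun z hz =>
  ⟨z, hz, 1, Or.inl rfl, div_one z⟩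

theorem div_subset_amplitudes (h0 : (0 : ℂ) ∈ G) (h1 : (1 : ℂ) ∈ G) :
    G / G ⊆ Amplitudes G := by
  rintro _ ⟨h, hh, g, hg, rfl⟩
  exact sum_subset_amplitudes (div_subset_add_div (subset_mul_self h1 h0)
    (div_mem_mul_div h1 g hg h hh))

theorem hadamard_mem_amplitudes (hG : PhaseClosed G) (h1 : (1 : ℂ) ∈ G) {n : ℕ} {ψ : QState n}
    {g : ℂ} (hg : g ∈ G) (hg0 : g ≠ 0) (hψ : ∀ x, g * ψ x ∈ G) (k : Fin n) (x : Fin n → Bool) :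
    (Gate.H k).apply ψ x ∈ Amplitudes G := by
  refine ⟨ψ (Function.update x k false) + (if x k then -1 else 1) * ψ (Function.update x k true),
    add_mem_add_div (subset_mul_self h1 hg) hg0 (subset_mul_self h1 (hψ _))
      (subset_mul_self h1 ?_), _, Or.inr rfl, rfl⟩
  rw [mul_left_comm]
  refine hG.mul_mem ?_ (hψ _)
  split_ifs <;> norm_num

/-- At every depth the gate acts on an edge leaving a tame node, so the transformed vector needs one
sum over one scale from `G` and a division by `√2`. The labels of the new edges are read off these
vectors. -/
theorem hGate_spec (O : Orders) (K : Kind) (hG : PhaseClosed G) (h0 : (0 : ℂ) ∈ G)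
    (h1 : (1 : ℂ) ∈ G) : ∀ {n : ℕ} (e : Edge n) (k : Fin n), Tame G e.node →
      (∃ g ∈ G, g ≠ 0 ∧ ∀ x, g * e.vec x ∈ G) →
      (hGate O K n e k).out.vec = (Gate.H k).apply e.vec ∧ Monic (hGate O K n e k).out.node ∧
        (hGate O K n e k).vals ⊆ Amplitudes G / Amplitudes G := by
  have hA := Amplitudes.phaseClosed hG
  have hGA := div_subset_amplitudes h0 h1
  have hA0 : (0 : ℂ) ∈ Amplitudes G := hGA ⟨0, h0, 1, h1, div_one 0⟩
  have hA1 : (1 : ℂ) ∈ Amplitudes G := hGA ⟨1, h1, 1, h1, div_one 1⟩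
  have hAQ := subset_div_self hA1
  have hSA := sum_subset_amplitudes (G := G)
  have hS1 : (1 : ℂ) ∈ (G * G + G * G) / (G * G) :=
    div_subset_add_div (subset_mul_self h1 h0) ⟨1, subset_mul_self h1 h1, 1,
      subset_mul_self h1 h1, div_one 1⟩
  have hS : ((G * G + G * G) / (G * G)) / ((G * G + G * G) / (G * G)) ⊆
      Amplitudes G / Amplitudes G := Set.div_subset_div hSA hSA
  intro n
  induction n with
  | zero => exact fun e k => k.elim0
  | succ n ih =>
    intro e k he ⟨g, hg, hg0, hv⟩
    obtain ⟨t, ht, ht0, htv⟩ := he.exists_scale h1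
    have hch : t * e.node.high.label.coeff ∈ G :=
      (he.child true).monic.coeff_mem hG (Tame.child_vec htv true)
    have hH : ∀ x, (Gate.H k).apply e.vec x ∈ Amplitudes G :=
      hadamard_mem_amplitudes hG h1 hg hg0 hv k
    have hHn : ∀ x, (Gate.H k).apply e.node.vec x ∈ Amplitudes G :=
      hadamard_mem_amplitudes hG h1 ht ht0 htv k
    have hce : e.label.coeff ∈ G / G :=
      ⟨_, he.monic.coeff_mem hG hv, g, hg, mul_div_cancel_left₀ _ hg0⟩
    have hB : (e.label.conjH k).coeff ∈ Amplitudes G := by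
      have h : (e.label.conjH k).coeff =
          (if e.label.pauli k = Pauli.Y then -1 else 1) * e.label.coeff := by
        simp only [LIM.conjH]
        split_ifs <;> simp
      rw [h]
      refine hA.mul_mem ?_ (hGA hce)
      split_ifs <;> norm_num
    -- The two cases differ only in how the node is transformed; the edge label is commuted past the
    -- gate once for both.
    suffices h : ∀ c : Run (Edge (n + 1)), c.out.vec = (Gate.H k).apply e.node.vec →
        Monic c.out.node → c.vals ⊆ Amplitudes G / Amplitudes G →
        (hGateFinish e k c).out.vec = (Gate.H k).apply e.vec ∧
          Monic (hGateFinish e k c).out.node ∧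
          (hGateFinish e k c).vals ⊆ Amplitudes G / Amplitudes G by
      by_cases hk : k = Fin.last n
      · subst hk
        rw [hGate_last]
        have hneg : (Edge.mk (e.node.high.label.smul (-1)) e.node.high.node).vec =
            fun y => -1 * e.node.high.vec y := LIM.smul_act _ _ _
        have hd : ∀ x, t * (-1 * e.node.high.vec x) ∈ G * G := fun x => by
          rw [mul_left_comm]
          exact hG.mul_left.mul_mem (by norm_num)
            (subset_mul_self h1 (Tame.child_vec htv true x))
        have hl : ∀ x, t * e.node.low.vec x ∈ G * G := fun x =>
          subset_mul_self h1 (Tame.child_vec htv false x)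
        have hr : ∀ x, t * e.node.high.vec x ∈ G * G := fun x =>
          subset_mul_self h1 (Tame.child_vec htv true x)
        obtain ⟨a1, a2, a3⟩ := add_spec O K h1 hG.mul_left (subset_mul_self h1 h0)
          (subset_mul_self h1 h1) (div_mem_mul_div h1) e.node.low e.node.high
          (he.child false) (he.child true) ⟨t, subset_mul_self h1 ht, ht0, hl, hr⟩
        obtain ⟨b1, b2, b3⟩ := add_spec O K h1 hG.mul_left (subset_mul_self h1 h0)
          (subset_mul_self h1 h1) (div_mem_mul_div h1) e.node.low
          ⟨e.node.high.label.smul (-1), e.node.high.node⟩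
          (he.child false) (he.child true) ⟨t, subset_mul_self h1 ht, ht0, hl, by rwa [hneg]⟩
        rw [hneg] at b1
        obtain ⟨m1, m2, m3⟩ := makeEdge_spec O K hA hA0 hA1 a2 b2
          (fun x => by
            rw [a1]
            exact hSA (add_mem_add_div (subset_mul_self h1 ht) ht0 (hl x) (hr x)))
          (fun x => by
            rw [b1]
            exact hSA (add_mem_add_div (subset_mul_self h1 ht) ht0 (hl x) (hd x)))
        set a₀ := (add O K n e.node.low e.node.high).out
        set a₁ := (add O K n e.node.low
          ⟨e.node.high.label.smul (-1), e.node.high.node⟩).out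
        have hvec : (mulEdge (LIM.scalar (n + 1) (1 / (Real.sqrt 2 : ℂ)))
            (makeEdge O K a₀ a₁).out).out.vec = (Gate.H (Fin.last n)).apply e.node.vec := by
          rw [vec_mulEdge, LIM.scalar_act, m1, a1, b1, hadamard_last, Node.top_vec, Node.top_vec]
          rfl
        refine h _ hvec m2 (Set.union_subset (a3.trans hS) (Set.union_subset ?_
          (Set.union_subset (b3.trans hS) (Set.union_subset m3 (Set.union_subset ?_ ?_)))))
        · refine Set.singleton_subset_iff.2 (hAQ (hA.mul_mem (by norm_num) (hGA ?_)))
          exact ⟨_, hch, t, ht, mul_div_cancel_left₀ _ ht0⟩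
        · exact Set.singleton_subset_iff.2 (hAQ
            ⟨1, hS1, _, Or.inr rfl, rfl⟩)
        · rw [vals_mulEdge, Set.singleton_subset_iff]
          refine hAQ (Monic.coeff_mem' (e := (mulEdge _ (makeEdge O K a₀ a₁).out).out) m2 hA
            fun x => ?_)
          rw [out_compute, hvec]
          exact hHn x
      · rw [hGate_of_ne O K n e hk]
        have C : ∀ b, _ := fun b => ih (e.node.child b) (k.castPred hk) (he.child b)
          ⟨t, ht, ht0, Tame.child_vec htv b⟩
        have hj : join ((Gate.H (k.castPred hk)).apply e.node.low.vec)
            ((Gate.H (k.castPred hk)).apply e.node.high.vec) = (Gate.H k).apply e.node.vec := by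
          rw [← hadamard_join, ← Node.vec_eq_join]
        obtain ⟨m1, m2, m3⟩ := makeEdge_spec O K hA hA0 hA1 (C false).2.1 (C true).2.1
          (fun x => by
            rw [(C false).1]
            exact hadamard_mem_amplitudes hG h1 ht ht0 (Tame.child_vec htv false) _ _)
          (fun x => by
            rw [(C true).1]
            exact hadamard_mem_amplitudes hG h1 ht ht0 (Tame.child_vec htv true) _ _)
        refine h _ ?_ m2
          (Set.union_subset (C false).2.2 (Set.union_subset (C true).2.2 m3))
        refine m1.trans ?_
        rw [(C false).1, (C true).1]
        exact hj
    intro c c1 c2 c3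
    have hvec : (hGateFinish e k c).out.vec = (Gate.H k).apply e.vec := by
      refine (vec_mulEdge _ _).trans ?_
      rw [c1, out_compute, Edge.vec, LIM.hadamard_act]
    have hmon : Monic (hGateFinish e k c).out.node := c2
    refine ⟨hvec, hmon, ?_⟩
    have hout : (hGateFinish e k c).out.label.coeff ∈ Amplitudes G :=
      hmon.coeff_mem' hA fun x => by
        rw [hvec]
        exact hH x
    simp only [hGateFinish, vals_bind, vals_emit, vals_compute, out_compute, vals_mulEdge,
      Set.union_subset_iff, Set.singleton_subset_iff]
    exact ⟨hAQ (hGA hce), c3, hAQ hB, hAQ hout⟩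

end HGate

/-! ## The edges of a normalized diagram -/

section Diagram

variable {G : Set ℂ} {K : Kind}

/-- Following edges with label `1` from the node down to the leaf reaches an entry `1`. -/
theorem Node.Normalized.monic : {n : ℕ} → {v : Node n} → v.Normalized K → Monic v
  | _, .leaf, _ => ⟨fun _ => false, rfl⟩
  | _, .node A v B w, h => by
    obtain ⟨-, -, hf, -, hv, hw⟩ := h
    have hcases : A = LIM.scalar _ 1 ∨ B = LIM.scalar _ 1 := by
      cases K
      · exact hf.imp_right And.right
      · exact Or.inl hf
    rcases hcases with h | h
    · exact h ▸ hv.monic.of_low _ _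
    · exact h ▸ hw.monic.of_high _ _

theorem Monic.exists_scale (hG : PhaseClosed G) {n : ℕ} {e : Edge n} (m : Monic e.node)
    (hc : e.label.coeff ≠ 0) (h : ∃ g ∈ G, g ≠ 0 ∧ ∀ x, g * e.vec x ∈ G) :
    ∃ g ∈ G, g ≠ 0 ∧ ∀ x, g * e.node.vec x ∈ G := by
  obtain ⟨g, -, hg0, hv⟩ := h
  refine ⟨_, m.coeff_mem hG hv, mul_ne_zero hg0 hc, fun x => ?_⟩
  obtain ⟨u, hu, y, hy⟩ := LIM.exists_eq_act e.label e.node.vec x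
  refine hG.mem_of_mul_mem hu ?_
  have := hv y
  rw [Edge.vec, hy] at this
  convert this using 1
  ring

/-- A nonzero edge passes the scale of its source on to its target, multiplied by the label
coefficient. A zero edge passes nothing on, but its target is also that of its nonzero sibling; this
is where the normalization of zero edges enters. -/
theorem Node.Normalized.tame (hG : PhaseClosed G) : {n : ℕ} → {v : Node n} → v.Normalized K →
    (∃ g ∈ G, g ≠ 0 ∧ ∀ x, g * v.vec x ∈ G) → Tame G v
  | _, .leaf, _, _ => trivial
  | n + 1, .node A v B w, h, hs => by
    obtain ⟨-, -, hf, hz, hv, hw⟩ := h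
    have hcases : A = LIM.scalar _ 1 ∨ (A.coeff = 0 ∧ B = LIM.scalar _ 1) := by
      cases K
      · exact hf.imp_right fun h => ⟨by rw [h.1]; rfl, h.2⟩
      · exact Or.inl hf
    have hlow : A.coeff ≠ 0 → ∃ g ∈ G, g ≠ 0 ∧ ∀ x, g * v.vec x ∈ G := fun hA => by
      obtain ⟨g, hg, hg0, h⟩ := hs
      exact Monic.exists_scale hG (e := ⟨A, v⟩) hv.monic hA
        ⟨g, hg, hg0, Tame.child_vec h false⟩
    have hhigh : B.coeff ≠ 0 → ∃ g ∈ G, g ≠ 0 ∧ ∀ x, g * w.vec x ∈ G := fun hB => by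
      obtain ⟨g, hg, hg0, h⟩ := hs
      exact Monic.exists_scale hG (e := ⟨B, w⟩) hw.monic hB
        ⟨g, hg, hg0, Tame.child_vec h true⟩
    have hne : A.coeff ≠ 0 ∨ B.coeff ≠ 0 := by
      rcases hcases with h | ⟨-, h⟩
      · exact Or.inl (h ▸ one_ne_zero)
      · exact Or.inr (h ▸ one_ne_zero)
    refine ⟨hcases, hs, hv.tame hG ?_, hw.tame hG ?_⟩
    · by_cases hA : A.coeff = 0
      · rw [hz (Or.inl hA)]
        exact hhigh (hne.resolve_left (not_not.2 hA))
      · exact hlow hA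
    · by_cases hB : B.coeff = 0
      · rw [← hz (Or.inr hB)]
        exact hlow (hne.resolve_right (not_not.2 hB))
      · exact hhigh hB

theorem EdgeOf.tame (h1 : (1 : ℂ) ∈ G) {n : ℕ} {r : Edge n} (hr : Tame G r.node)
    (hs : ∀ x, r.vec x ∈ G) {m : ℕ} {e : Edge m} (he : EdgeOf r e) :
    Tame G e.node ∧ ∃ g ∈ G, g ≠ 0 ∧ ∀ x, g * e.vec x ∈ G := by
  induction he with
  | root => exact ⟨hr, 1, h1, one_ne_zero, by simpa using hs⟩
  | low _ ih =>
    obtain ⟨t, ht, ht0, h⟩ := ih.1.exists_scale h1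
    exact ⟨ih.1.child false, t, ht, ht0, Tame.child_vec h false⟩
  | high _ ih =>
    obtain ⟨t, ht, ht0, h⟩ := ih.1.exists_scale h1
    exact ⟨ih.1.child true, t, ht, ht0, Tame.child_vec h true⟩

theorem Computed.mem_div (O : Orders) (hG : PhaseClosed G) (h0 : (0 : ℂ) ∈ G) (h1 : (1 : ℂ) ∈ G)
    {n : ℕ} {r : Edge n} (hr : Tame G r.node) (hs : ∀ x, r.vec x ∈ G) {z : ℂ}
    (hz : Computed O K r z) : z ∈ Amplitudes G / Amplitudes G := by
  have hD : PhaseClosed (G / G) := hG.div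
  have hGA := div_subset_amplitudes h0 h1
  have hD0 : (0 : ℂ) ∈ G / G := subset_div_self h1 h0
  have hD1 : (1 : ℂ) ∈ G / G := subset_div_self h1 h1
  have hGQ : G / G ⊆ Amplitudes G / Amplitudes G := hGA.trans (subset_div_self (hGA hD1))
  have hQQ : (G / G) / (G / G) ⊆ Amplitudes G / Amplitudes G := Set.div_subset_div hGA hGA
  have T : ∀ {m : ℕ} {e : Edge m}, EdgeOf r e → _ := fun he => he.tame h1 hr hs
  have V : ∀ {m : ℕ} {e : Edge m}, EdgeOf r e → ∀ x, e.vec x ∈ G / G := fun he x => by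
    obtain ⟨-, g, hg, hg0, h⟩ := T he
    exact ⟨_, h x, g, hg, mul_div_cancel_left₀ _ hg0⟩
  cases hz with
  | hGate k hz => exact (hGate_spec O K hG h0 h1 r k hr (T .root).2).2.2 hz
  | add he hf hz =>
    obtain ⟨te, g, hg, hg0, hge⟩ := T he
    obtain ⟨tf, h, hh, hh0, hhf⟩ := T hf
    -- Two edges from unrelated places have different scales `g` and `h`. Their product is a common
    -- scale, which is why `Amplitudes` is built from `G * G`.
    refine Set.div_subset_div sum_subset_amplitudes sum_subset_amplitudes
      ((add_spec O K h1 hG.mul_left (subset_mul_self h1 h0) (subset_mul_self h1 h1)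
        (div_mem_mul_div h1) _ _ te tf ⟨g * h, ⟨g, hg, h, hh, rfl⟩, mul_ne_zero hg0 hh0,
          fun x => ⟨_, hge x, h, hh, ?_⟩, fun x => ⟨g, hg, _, hhf x, ?_⟩⟩).2.2 hz)
    · exact mul_right_comm _ _ _
    · exact (mul_assoc _ _ _).symm
  | follow he x hz =>
    exact hGQ ((follow_spec hD h1 (fun g hg h hh => ⟨h, hh, g, hg, rfl⟩) _ _ x (T he).1
      ((T he).1.monic.coeff_mem' hD (V he)) (V he)).2.2 hz)
  | makeEdge he hf _ hz =>
    exact hQQ ((makeEdge_spec O K hD hD0 hD1 (T he).1.monic (T hf).1.monic (V he) (V hf)).2.2 hz)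
  | getLabels he hf h hz =>
    have hc := (T hf).1.monic.coeff_mem' hD (V hf)
    exact hQQ ((getLabels_spec O K hD.div (subset_div_self hD1 hD1) (T he).1.monic
      (T hf).1.monic h (subset_div_self hD1 hc) ⟨1, hD1, _, hc, one_div _⟩).1 hz)

/-- The numbers `0`, `u` and `u * ψ x` with `u ^ 4 = 1`. -/
def phases {n : ℕ} (ψ : QState n) : Set ℂ :=
  {z | ∃ u w : ℂ, u ^ 4 = 1 ∧ z = u * w ∧ (w = 0 ∨ w = 1 ∨ ∃ x, w = ψ x)}

theorem phases_phaseClosed {n : ℕ} (ψ : QState n) : PhaseClosed (phases ψ) := by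
  rintro _ ⟨u, w, hu, rfl, hw⟩
  exact ⟨Complex.I * u, w, by rw [mul_pow, hu, Complex.I_pow_four, one_mul],
    (mul_assoc _ _ _).symm, hw⟩

theorem Edge.Normalized.mem_div_of_computed (O : Orders) {n : ℕ} {r : Edge n}
    (hr : r.Normalized K) (h0 : ∃ x, r.vec x ≠ 0) {z : ℂ} (hz : Computed O K r z) :
    z ∈ Amplitudes (phases r.vec) / Amplitudes (phases r.vec) := by
  have hG := phases_phaseClosed r.vec
  have hv : ∀ x, r.vec x ∈ phases r.vec := fun x =>
    ⟨1, r.vec x, one_pow 4, (one_mul _).symm, Or.inr (Or.inr ⟨x, rfl⟩)⟩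
  have m1 : (1 : ℂ) ∈ phases r.vec :=
    ⟨1, 1, one_pow 4, (one_mul _).symm, Or.inr (Or.inl rfl)⟩
  -- A zero root label would carry no information about the nodes below it.
  have hc : r.label.coeff ≠ 0 := fun h => by
    obtain ⟨x, hx⟩ := h0
    exact hx (congrFun (LIM.act_of_coeff_eq_zero h _) x)
  exact hz.mem_div O hG ⟨1, 0, one_pow 4, (one_mul _).symm, Or.inl rfl⟩ m1
    (hr.2.tame hG (hr.2.monic.exists_scale hG hc ⟨1, m1, one_ne_zero, by simpa using hv⟩)) hv

end Diagram

/-! ## Heights of elements of `ℚ(i, √2)` -/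

/-- The number `a + b√2 + ci + di√2`. -/
def quad (a b c d : ℤ) : ℂ :=
  a + b * (Real.sqrt 2 : ℂ) + c * Complex.I + d * Complex.I * (Real.sqrt 2 : ℂ)

/-- The numbers `(a + b√2 + ci + di√2) / D` with integers `a, b, c, d, D` of absolute value at most
`2 ^ m`. -/
def Height (m : ℕ) : Set ℂ :=
  {z | ∃ a b c d : ℤ, ∃ D : ℕ, D ≠ 0 ∧ D ≤ 2 ^ m ∧ |a| ≤ 2 ^ m ∧ |b| ≤ 2 ^ m ∧ |c| ≤ 2 ^ m ∧
    |d| ≤ 2 ^ m ∧ z * D = quad a b c d}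

theorem sqrt_two_sq : (Real.sqrt 2 : ℂ) ^ 2 = 2 := by
  rw [← Complex.ofReal_pow, Real.sq_sqrt zero_le_two]
  norm_num

theorem Height.mono {m l : ℕ} (h : m ≤ l) : Height m ⊆ Height l := by
  rintro z ⟨a, b, c, d, D, hD, hD', ha, hb, hc, hd, hz⟩
  have h1 : (2 : ℤ) ^ m ≤ 2 ^ l := pow_le_pow_right₀ one_le_two h
  exact ⟨a, b, c, d, D, hD, hD'.trans (pow_le_pow_right₀ one_le_two h), ha.trans h1,
    hb.trans h1, hc.trans h1, hd.trans h1, hz⟩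

theorem abs_mul_le_of_le {x y X Y : ℤ} (hx : |x| ≤ X) (hy : |y| ≤ Y) : |x * y| ≤ X * Y := by
  rw [abs_mul]
  exact mul_le_mul hx hy (abs_nonneg _) ((abs_nonneg _).trans hx)

theorem Height.add_mem {m l : ℕ} {z w : ℂ} (hz : z ∈ Height m) (hw : w ∈ Height l) :
    z + w ∈ Height (m + l + 1) := by
  obtain ⟨a, b, c, d, D, hD, hD', ha, hb, hc, hd, hz⟩ := hz
  obtain ⟨a', b', c', d', E, hE, hE', ha', hb', hc', hd', hw⟩ := hw
  have hDz : |(D : ℤ)| ≤ 2 ^ m := by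
    rw [Nat.abs_cast]
    exact_mod_cast hD'
  have hEz : |(E : ℤ)| ≤ 2 ^ l := by
    rw [Nat.abs_cast]
    exact_mod_cast hE'
  have key : ∀ x y : ℤ, |x| ≤ 2 ^ m → |y| ≤ 2 ^ l → |x * E + y * D| ≤ 2 ^ (m + l + 1) := by
    intro x y hx hy
    have h1 := abs_mul_le_of_le hx hEz
    have h2 := abs_mul_le_of_le hy hDz
    have h3 := abs_add_le (x * E) (y * D)
    have h4 : (2 : ℤ) ^ (m + l + 1) = 2 ^ m * 2 ^ l + 2 ^ l * 2 ^ m := by ring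
    linarith
  refine ⟨_, _, _, _, D * E, mul_ne_zero hD hE, ?_, key a a' ha ha', key b b' hb hb',
    key c c' hc hc', key d d' hd hd', ?_⟩
  · rw [pow_succ, pow_add]
    exact (Nat.mul_le_mul hD' hE').trans (Nat.le_mul_of_pos_right _ two_pos)
  · simp only [quad] at hz hw ⊢
    push_cast
    linear_combination (E : ℂ) * hz + (D : ℂ) * hw

theorem Height.mul_mem {m l : ℕ} {z w : ℂ} (hz : z ∈ Height m) (hw : w ∈ Height l) :
    z * w ∈ Height (m + l + 3) := by
  obtain ⟨a, b, c, d, D, hD, hD', ha, hb, hc, hd, hz⟩ := hz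
  obtain ⟨a', b', c', d', E, hE, hE', ha', hb', hc', hd', hw⟩ := hw
  -- Each coordinate of a product is a sum of four products with weights adding up to at most `6`,
  -- and `6 ≤ 2 ^ 3`.
  have h8 : (2 : ℤ) ^ (m + l + 3) = 8 * (2 ^ m * 2 ^ l) := by ring
  have hP : (0 : ℤ) ≤ 2 ^ m * 2 ^ l := by positivity
  have key : ∀ x y : ℤ, |x| ≤ 2 ^ m → |y| ≤ 2 ^ l →
      -(2 ^ m * 2 ^ l) ≤ x * y ∧ x * y ≤ 2 ^ m * 2 ^ l :=
    fun x y hx hy => abs_le.1 (abs_mul_le_of_le hx hy)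
  have aa := key _ _ ha ha'
  have ab := key _ _ ha hb'
  have ac := key _ _ ha hc'
  have ad := key _ _ ha hd'
  have ba := key _ _ hb ha'
  have bb := key _ _ hb hb'
  have bc := key _ _ hb hc'
  have bd := key _ _ hb hd'
  have ca := key _ _ hc ha'
  have cb := key _ _ hc hb'
  have cc := key _ _ hc hc'
  have cd := key _ _ hc hd'
  have da := key _ _ hd ha'
  have db := key _ _ hd hb'
  have dc := key _ _ hd hc'
  have dd := key _ _ hd hd'
  refine ⟨a * a' + 2 * (b * b') - c * c' - 2 * (d * d'), a * b' + b * a' - c * d' - d * c',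
    a * c' + c * a' + 2 * (b * d') + 2 * (d * b'), a * d' + d * a' + b * c' + c * b',
    D * E, mul_ne_zero hD hE, ?_, ?_, ?_, ?_, ?_, ?_⟩
  · rw [pow_add, pow_add]
    exact (Nat.mul_le_mul hD' hE').trans (Nat.le_mul_of_pos_right _ (by positivity))
  · rw [h8, abs_le]
    constructor <;> linarith
  · rw [h8, abs_le]
    constructor <;> linarith
  · rw [h8, abs_le]
    constructor <;> linarith
  · rw [h8, abs_le]
    constructor <;> linarith
  · have h : z * w * ((D * E : ℕ) : ℂ) = (z * D) * (w * E) := by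
      push_cast
      ring
    rw [h, hz, hw]
    simp only [quad]
    push_cast
    have hs := sqrt_two_sq
    have hI := Complex.I_sq
    generalize (Real.sqrt 2 : ℂ) = s at *
    linear_combination (b * b' + (b * d' + d * b') * Complex.I + d * d' * Complex.I ^ 2) * hs +
      (c * c' + (c * d' + d * c') * s + 2 * d * d') * hI

/-! ### Inverses in `ℚ(i, √2)`. -/

theorem eq_zero_of_sq_eq_two_mul_sq {x y : ℤ} (h : x ^ 2 = 2 * y ^ 2) : y = 0 := by
  by_contra hy
  refine irrational_sqrt_two ⟨|(x : ℚ) / y|, ?_⟩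
  have hy' : (y : ℝ) ≠ 0 := by exact_mod_cast hy
  have h' : (x : ℝ) ^ 2 = 2 * (y : ℝ) ^ 2 := by exact_mod_cast h
  rw [eq_comm, Real.sqrt_eq_iff_mul_self_eq zero_le_two (by positivity)]
  push_cast
  rw [abs_mul_abs_self]
  field_simp
  exact h'.symm

/-- The hypotheses say `α² = 2β²` for `α = a + ci` and `β = b + di`. Multiplying by the square of
the conjugate of `β` gives `(x + iy)² = 2(b² + d²)²` with integers `x`, `y`. So `x = 0` or `y = 0`:
positivity settles the first case, irrationality of `√2` the second. -/
theorem eq_zero_of_gaussian_sq_eq {a b c d : ℤ} (hu : a ^ 2 - c ^ 2 - 2 * b ^ 2 + 2 * d ^ 2 = 0)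
    (hv : 2 * a * c - 4 * b * d = 0) : a = 0 ∧ b = 0 ∧ c = 0 ∧ d = 0 := by
  have h1 : (a * b + c * d) * (c * b - a * d) = 0 := by
    have : 2 * ((a * b + c * d) * (c * b - a * d)) = 0 := by
      linear_combination (b ^ 2 - d ^ 2) * hv - 2 * b * d * hu
    omega
  have h2 : (a * b + c * d) ^ 2 - (c * b - a * d) ^ 2 = 2 * (b ^ 2 + d ^ 2) ^ 2 := by
    linear_combination (b ^ 2 - d ^ 2) * hu + 2 * b * d * hv
  have hM : b ^ 2 + d ^ 2 = 0 := by
    rcases mul_eq_zero.1 h1 with h | h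
    · rw [h] at h2
      have h3 : (b ^ 2 + d ^ 2) ^ 2 = 0 := by
        nlinarith [sq_nonneg (c * b - a * d), sq_nonneg (b ^ 2 + d ^ 2)]
      exact pow_eq_zero_iff two_ne_zero |>.1 h3
    · rw [h] at h2
      exact eq_zero_of_sq_eq_two_mul_sq (x := a * b + c * d) (by linarith)
  have hb : b = 0 := by nlinarith [sq_nonneg b, sq_nonneg d]
  have hd : d = 0 := by nlinarith [sq_nonneg b, sq_nonneg d]
  subst hb hd
  have hac : a * c = 0 := by linarith
  rcases mul_eq_zero.1 hac with h | h <;> subst h <;> simp_all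

/-- The denominator is made rational in two steps: multiplication by the conjugate under `√2 ↦ -√2`
gives a Gaussian integer `u + vi`, and then `u - vi` gives `u² + v²`, which is nonzero because `√2 ∉
ℚ(i)`. -/
theorem Height.inv_mem {m : ℕ} {z : ℂ} (hz : z ∈ Height m) : z⁻¹ ∈ Height (4 * m + 7) := by
  obtain ⟨a, b, c, d, D, hD, hD', ha, hb, hc, hd, hz⟩ := hz
  by_cases hz0 : z = 0
  · refine ⟨0, 0, 0, 0, 1, one_ne_zero, Nat.one_le_two_pow, ?_, ?_, ?_, ?_, ?_⟩ <;>
      simp [hz0, quad]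
  set X : ℤ := 2 ^ m with hX
  have hDz : |(D : ℤ)| ≤ X := by
    rw [Nat.abs_cast, hX]
    exact_mod_cast hD'
  -- With `|u|, |v| ≤ 6X²` the new denominator is at most `72X⁴` and the new coordinates at most
  -- `12X⁴`; both are below `2 ^ 7 * X⁴`.
  have h128 : (2 : ℤ) ^ (4 * m + 7) = 128 * (X * X * (X * X)) := by
    rw [hX]
    ring
  have hP : (0 : ℤ) ≤ X * X * (X * X) := by positivity
  have key : ∀ x y : ℤ, |x| ≤ X → |y| ≤ X → -(X * X) ≤ x * y ∧ x * y ≤ X * X :=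
    fun x y hx hy => abs_le.1 (abs_mul_le_of_le hx hy)
  set u : ℤ := a * a - c * c - 2 * (b * b) + 2 * (d * d) with hu
  set v : ℤ := 2 * (a * c) - 4 * (b * d) with hv
  have hub : |u| ≤ 6 * (X * X) := by
    have aa := key _ _ ha ha
    have bb := key _ _ hb hb
    have cc := key _ _ hc hc
    have dd := key _ _ hd hd
    rw [abs_le]
    constructor <;> linarith
  have hvb : |v| ≤ 6 * (X * X) := by
    have ac := key _ _ ha hc
    have bd := key _ _ hb hd
    rw [abs_le]
    constructor <;> linarith
  have hN : u * u + v * v ≠ 0 := fun h => by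
    have hu0 : u = 0 := by nlinarith [mul_self_nonneg u, mul_self_nonneg v]
    have hv0 : v = 0 := by nlinarith [mul_self_nonneg u, mul_self_nonneg v]
    obtain ⟨rfl, rfl, rfl, rfl⟩ := eq_zero_of_gaussian_sq_eq (a := a) (b := b) (c := c) (d := d)
      (by linarith) (by linarith)
    simp [quad, hz0, hD] at hz
  have comb : ∀ x y s t : ℤ, |x| ≤ X → |y| ≤ X → |s| ≤ 6 * (X * X) → |t| ≤ 6 * (X * X) →
      |D * (x * s + y * t)| ≤ 2 ^ (4 * m + 7) := by
    intro x y s t hx hy hs ht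
    have h1 := abs_mul_le_of_le hx hs
    have h2 := abs_mul_le_of_le hy ht
    have h3 := (abs_add_le (x * s) (y * t)).trans (add_le_add h1 h2)
    have h4 := abs_mul_le_of_le hDz h3
    rw [h128]
    refine h4.trans ?_
    nlinarith
  have nu : |-u| ≤ 6 * (X * X) := by rwa [abs_neg]
  have nv : |-v| ≤ 6 * (X * X) := by rwa [abs_neg]
  refine ⟨D * (a * u + c * v), D * (b * -u + d * -v), D * (c * u + a * -v),
    D * (d * -u + b * v), (u * u + v * v).natAbs, Int.natAbs_ne_zero.2 hN, ?_,
    comb _ _ _ _ ha hc hub hvb, comb _ _ _ _ hb hd nu nv, comb _ _ _ _ hc ha hub nv,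
    comb _ _ _ _ hd hb nu hvb, ?_⟩
  · have h1 := (abs_add_le (u * u) (v * v)).trans
      (add_le_add (abs_mul_le_of_le hub hub) (abs_mul_le_of_le hvb hvb))
    have h2 : ((u * u + v * v).natAbs : ℤ) ≤ ((2 ^ (4 * m + 7) : ℕ) : ℤ) := by
      rw [Int.natCast_natAbs]
      push_cast
      rw [h128]
      linarith
    exact_mod_cast h2
  · have hcast : ((u * u + v * v).natAbs : ℂ) = ((u * u + v * v : ℤ) : ℂ) := by
      rw [← Int.cast_natCast (R := ℂ), Int.natCast_natAbs,
        abs_of_nonneg (add_nonneg (mul_self_nonneg u) (mul_self_nonneg v))]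
    rw [hcast, inv_mul_eq_iff_eq_mul₀ hz0]
    have hq : quad (D * (a * u + c * v)) (D * (b * -u + d * -v)) (D * (c * u + a * -v))
        (D * (d * -u + b * v)) =
        D * ((a - b * (Real.sqrt 2 : ℂ) + c * Complex.I - d * Complex.I * (Real.sqrt 2 : ℂ)) *
          (u - v * Complex.I)) := by
      simp only [quad]
      push_cast
      linear_combination (D : ℂ) * (c * v - d * v * (Real.sqrt 2 : ℂ)) * Complex.I_sq
    have hp : quad a b c d *
        (a - b * (Real.sqrt 2 : ℂ) + c * Complex.I - d * Complex.I * (Real.sqrt 2 : ℂ)) =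
        u + v * Complex.I := by
      simp only [quad, hu, hv]
      push_cast
      have hs := sqrt_two_sq
      have hI := Complex.I_sq
      generalize (Real.sqrt 2 : ℂ) = s at *
      linear_combination (-(b + d * Complex.I) ^ 2) * hs + (c ^ 2 - 2 * d ^ 2) * hI
    rw [hq, ← mul_assoc, hz, ← mul_assoc, hp]
    push_cast
    linear_combination (v : ℂ) ^ 2 * Complex.I_sq

theorem Height.div_mem {m l : ℕ} {z w : ℂ} (hz : z ∈ Height m) (hw : w ∈ Height l) :
    z / w ∈ Height (m + 4 * l + 10) := by
  rw [div_eq_mul_inv]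
  exact Height.mono (by omega) (Height.mul_mem hz (Height.inv_mem hw))

/-- Reduction to lowest terms replaces numerator and denominator by divisors. -/
theorem rat_bounds {a : ℤ} {D m : ℕ} (hD : D ≠ 0) (hD' : D ≤ 2 ^ m) (ha : |a| ≤ 2 ^ m) :
    (Rat.divInt a D).num.natAbs ≤ 2 ^ m ∧ (Rat.divInt a D).den ≤ 2 ^ m := by
  have hD0 : (D : ℤ) ≠ 0 := by exact_mod_cast hD
  constructor
  · have ha' : a.natAbs ≤ 2 ^ m := by
      have : (a.natAbs : ℤ) ≤ ((2 ^ m : ℕ) : ℤ) := by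
        rw [Int.natCast_natAbs]
        push_cast
        exact ha
      exact_mod_cast this
    by_cases h0 : a = 0
    · simp [h0]
    · exact (Nat.le_of_dvd (Int.natAbs_pos.2 h0)
        (Int.natAbs_dvd_natAbs.2 (Rat.num_dvd a hD0))).trans ha'
  · exact (Nat.le_of_dvd (Nat.pos_of_ne_zero hD)
      (Int.natCast_dvd_natCast.1 (Rat.den_dvd a D))).trans hD'

theorem Height.subset_R (m : ℕ) : Height m ⊆ R m := by
  rintro z ⟨a, b, c, d, D, hD, hD', ha, hb, hc, hd, hz⟩
  refine ⟨Rat.divInt a D, Rat.divInt b D, Rat.divInt c D, Rat.divInt d D, ?_, ?_⟩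
  · intro q hq
    simp only [List.mem_cons, List.not_mem_nil, or_false] at hq
    rcases hq with rfl | rfl | rfl | rfl
    · exact rat_bounds hD hD' ha
    · exact rat_bounds hD hD' hb
    · exact rat_bounds hD hD' hc
    · exact rat_bounds hD hD' hd
  · have hD0 : (D : ℂ) ≠ 0 := by exact_mod_cast hD
    simp only [Rat.divInt_eq_div]
    push_cast
    rw [eq_div_of_mul_eq hD0 hz, quad]
    field_simp

/-! ## Circuits over a commutative ring -/

section Circuit

variable {A : Type*} [CommRing A] {n : ℕ}

/-- The diagonal operator that multiplies by `ζ` where qubit `i` is `1`. -/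
def diagGate (i : Fin n) (ζ : A) : ((Fin n → Bool) → A) →ₗ[A] ((Fin n → Bool) → A) where
  toFun ψ x := (if x i then ζ else 1) * ψ x
  map_add' _ _ := funext fun _ => mul_add _ _ _
  map_smul' _ _ := funext fun _ => mul_left_comm _ _ _

/-- The Hadamard gate, where `h` plays the role of `1/√2`. -/
def hadamardGate (h : A) (i : Fin n) : ((Fin n → Bool) → A) →ₗ[A] ((Fin n → Bool) → A) where
  toFun ψ x := h * (ψ (Function.update x i false) +
    (if x i then -1 else 1) * ψ (Function.update x i true))
  map_add' ψ φ := funext fun x => by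
    simp only [Pi.add_apply]
    ring
  map_smul' c ψ := funext fun x => by
    simp only [Pi.smul_apply, smul_eq_mul, RingHom.id_apply]
    ring

/-- The gate `CNOT`. -/
def cnotGate (c t : Fin n) : ((Fin n → Bool) → A) →ₗ[A] ((Fin n → Bool) → A) where
  toFun ψ x := ψ (Function.update x t (xor (x t) (x c)))
  map_add' _ _ := rfl
  map_smul' _ _ := rfl

/-- The linear operator of a gate, where `h` plays the role of `1/√2` and `w` that of
`exp (iπ/4)`. -/
def Gate.lin (h w : A) : Gate n → ((Fin n → Bool) → A) →ₗ[A] ((Fin n → Bool) → A)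
  | .H i => hadamardGate h i
  | .S i => diagGate i (w ^ 2)
  | .T i => diagGate i w
  | .CNOT c t _ => cnotGate c t

/-- The vector produced by a circuit, where `h` plays the role of `1/√2` and `w` that of
`exp (iπ/4)`. -/
def outputOver (h w : A) (C : List (Gate n)) : (Fin n → Bool) → A :=
  C.foldl (fun ψ g => g.lin h w ψ) fun x => if x = fun _ => false then 1 else 0

theorem outputOver_concat (h w : A) (C : List (Gate n)) (g : Gate n) :
    outputOver h w (C ++ [g]) = g.lin h w (outputOver h w C) := by
  simp [outputOver]

/-- Used for the two projections of `ℂ × ℂ`: one integral expansion over the product ring then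
describes a circuit and its conjugate simultaneously. -/
theorem map_outputOver {B : Type*} [CommRing B] (φ : A →+* B) (h w : A) (C : List (Gate n)) :
    ∀ x, φ (outputOver h w C x) = outputOver (φ h) (φ w) C x := by
  induction C using List.reverseRecOn with
  | nil =>
    intro x
    simp only [outputOver, List.foldl_nil]
    split_ifs <;> simp
  | append_singleton C g ih =>
    intro x
    rw [outputOver_concat, outputOver_concat]
    cases g with
    | H i =>
      simp only [Gate.lin, hadamardGate, LinearMap.coe_mk, AddHom.coe_mk, map_mul, map_add, ih]
      split_ifs <;> simp
    | S i =>
      simp only [Gate.lin, diagGate, LinearMap.coe_mk, AddHom.coe_mk, map_mul, ih]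
      split_ifs <;> simp
    | T i =>
      simp only [Gate.lin, diagGate, LinearMap.coe_mk, AddHom.coe_mk, map_mul, ih]
      split_ifs <;> simp
    | CNOT c t hct =>
      simp only [Gate.lin, cnotGate, LinearMap.coe_mk, AddHom.coe_mk, ih]

/-! ## The Barnes–Wall lattice -/

/-- The product vector with factor `s |0⟩` at the qubits in `u` and `|0⟩ + |1⟩` at the others. -/
def latticeVec (s : A) (u : Finset (Fin n)) (x : Fin n → Bool) : A :=
  if ∀ i ∈ u, x i = false then s ^ u.card else 0

theorem latticeVec_insert (s : A) {u : Finset (Fin n)} {i : Fin n} (hi : i ∉ u)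
    (x : Fin n → Bool) :
    latticeVec s (insert i u) x = if x i then 0 else s * latticeVec s u x := by
  cases h : x i <;> simp [latticeVec, Finset.card_insert_of_notMem hi, pow_succ', h]

theorem latticeVec_update (s : A) {u : Finset (Fin n)} {i : Fin n} (hi : i ∉ u)
    (x : Fin n → Bool) (b : Bool) :
    latticeVec s u (Function.update x i b) = latticeVec s u x := by
  have : (∀ j ∈ u, Function.update x i b j = false) ↔ ∀ j ∈ u, x j = false :=
    forall₂_congr fun j hj => by
      rw [Function.update_of_ne (ne_of_mem_of_not_mem hj hi)]
  simp only [latticeVec, this]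

/-- The Barnes–Wall lattice over `ℤ[w]`, where `w` plays the role of `exp (iπ/4)`. -/
def lattice (w : A) (n : ℕ) : Submodule (Algebra.adjoin ℤ {w}) ((Fin n → Bool) → A) :=
  Submodule.span _ (Set.range (latticeVec (w - w ^ 3)))

theorem smul_mem_lattice {w c : A} (hc : c ∈ Algebra.adjoin ℤ {w}) {ψ : (Fin n → Bool) → A}
    (hψ : ψ ∈ lattice w n) : c • ψ ∈ lattice w n :=
  (lattice w n).smul_mem ⟨c, hc⟩ hψ

theorem latticeVec_mem (w : A) (u : Finset (Fin n)) :
    latticeVec (w - w ^ 3) u ∈ lattice w n :=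
  Submodule.subset_span ⟨u, rfl⟩

theorem map_mem_lattice {w : A} (f : ((Fin n → Bool) → A) →ₗ[A] ((Fin n → Bool) → A))
    (hf : ∀ u, f (latticeVec (w - w ^ 3) u) ∈ lattice w n) {ψ : (Fin n → Bool) → A}
    (hψ : ψ ∈ lattice w n) : f ψ ∈ lattice w n := by
  induction hψ using Submodule.span_induction with
  | mem _ h =>
    obtain ⟨u, rfl⟩ := h
    exact hf u
  | zero => simp
  | add _ _ _ _ h h' =>
    rw [map_add]
    exact add_mem h h'
  | smul c ψ _ h =>
    rw [show c • ψ = (c : A) • ψ from rfl, map_smul]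
    exact smul_mem_lattice c.2 h

theorem self_mem (w : A) : w ∈ Algebra.adjoin ℤ {w} := Algebra.self_mem_adjoin_singleton ℤ w

theorem sqrtTwo_mem (w : A) : w - w ^ 3 ∈ Algebra.adjoin ℤ {w} :=
  sub_mem (self_mem w) (pow_mem (self_mem w) 3)

theorem forall_finset_cases {i : Fin n} {P : Finset (Fin n) → Prop} (h : ∀ u, i ∉ u → P u)
    (h' : ∀ u, i ∉ u → P (insert i u)) (u : Finset (Fin n)) : P u := by
  by_cases hi : i ∈ u
  · rw [← Finset.insert_erase hi]
    exact h' _ (Finset.notMem_erase _ _)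
  · exact h u hi

/-- The gate exchanges the two possible factors `√2|0⟩` and `|0⟩ + |1⟩` at qubit `i`. -/
theorem hadamardGate_mem_lattice {h w : A} (hw : w ^ 4 = -1) (hh : h * (w - w ^ 3) = 1)
    (i : Fin n) (u : Finset (Fin n)) :
    hadamardGate h i (latticeVec (w - w ^ 3) u) ∈ lattice w n := by
  have hs : h * 2 = w - w ^ 3 := by
    linear_combination (w - w ^ 3) * hh + h * (2 - w ^ 2) * hw
  induction u using forall_finset_cases (i := i) with
  | h u hi =>
    convert latticeVec_mem w (insert i u)
    funext x
    rw [latticeVec_insert _ hi]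
    simp only [hadamardGate, LinearMap.coe_mk, AddHom.coe_mk, latticeVec_update _ hi]
    cases x i
    · simp only [Bool.false_eq_true, if_false]
      linear_combination latticeVec (w - w ^ 3) u x * hs
    · simp
  | h' u hi =>
    convert latticeVec_mem w u
    funext x
    simp only [hadamardGate, LinearMap.coe_mk, AddHom.coe_mk, latticeVec_insert _ hi,
      latticeVec_update _ hi, Function.update_self, Bool.false_eq_true, if_false, if_true]
    linear_combination latticeVec (w - w ^ 3) u x * hh

/-- At qubit `i` the factor `√2|0⟩` is fixed, and `m(|0⟩ + ζ|1⟩) = mζ(|0⟩ + |1⟩) + c√2|0⟩`. For `S`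
one may take `m = 1`, since `1 - i` is `√2` times a unit; for `T` the choice is `m = √2`, `c = 1 -
ω`. This is the factor `√2` that each `T` gate costs. -/
theorem diagGate_mem_lattice {w m ζ c : A} (hm : m ∈ Algebra.adjoin ℤ {w})
    (hζ : m * ζ ∈ Algebra.adjoin ℤ {w}) (hc : c ∈ Algebra.adjoin ℤ {w})
    (h : m * (1 - ζ) = c * (w - w ^ 3)) (i : Fin n) (u : Finset (Fin n)) :
    m • diagGate i ζ (latticeVec (w - w ^ 3) u) ∈ lattice w n := by
  induction u using forall_finset_cases (i := i) with
  | h u hi =>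
    convert add_mem (smul_mem_lattice hζ (latticeVec_mem w u))
      (smul_mem_lattice hc (latticeVec_mem w (insert i u)))
    funext x
    simp only [diagGate, LinearMap.coe_mk, AddHom.coe_mk, Pi.smul_apply, Pi.add_apply,
      smul_eq_mul, latticeVec_insert _ hi]
    cases x i
    · simp only [Bool.false_eq_true, if_false]
      linear_combination latticeVec (w - w ^ 3) u x * h
    · simp only [if_true]
      ring
  | h' u hi =>
    convert smul_mem_lattice hm (latticeVec_mem w (insert i u))
    funext x
    simp only [diagGate, LinearMap.coe_mk, AddHom.coe_mk, latticeVec_insert _ hi]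
    cases x i <;> simp

/-- The gate fixes a generator with `|0⟩ + |1⟩` at the target or `√2|0⟩` at the control. In the
remaining case the image `√2(|00⟩ + |11⟩)` is an integral combination of the four generators at
these two qubits, by `(√2)² = 2`. -/
theorem cnotGate_mem_lattice {w : A} (hw : w ^ 4 = -1) {c t : Fin n} (hct : c ≠ t)
    (u : Finset (Fin n)) :
    cnotGate c t (latticeVec (w - w ^ 3) u) ∈ lattice w n := by
  induction u using forall_finset_cases (i := t) with
  | h u hi =>
    convert latticeVec_mem w u
    funext x
    exact latticeVec_update _ hi _ _
  | h' u hi =>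
    have key : ∀ x, cnotGate c t (latticeVec (w - w ^ 3) (insert t u)) x =
        if xor (x t) (x c) then 0 else (w - w ^ 3) * latticeVec (w - w ^ 3) u x := fun x => by
      simp only [cnotGate, LinearMap.coe_mk, AddHom.coe_mk]
      rw [latticeVec_insert _ hi, latticeVec_update _ hi, Function.update_self]
    by_cases hc : c ∈ u
    · convert latticeVec_mem w (insert t u)
      funext x
      rw [key, latticeVec_insert _ hi]
      cases h : x c
      · simp
      · have : latticeVec (w - w ^ 3) u x = 0 :=
          if_neg fun h' => by simp [h' c hc] at h
        simp [this]
    · have hc' : c ∉ insert t u := by simp [hct, hc]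
      convert add_mem (sub_mem (sub_mem (smul_mem_lattice (sqrtTwo_mem w) (latticeVec_mem w u))
        (latticeVec_mem w (insert t u))) (latticeVec_mem w (insert c u)))
        (smul_mem_lattice (sqrtTwo_mem w) (latticeVec_mem w (insert c (insert t u))))
      funext x
      rw [key]
      simp only [Pi.add_apply, Pi.sub_apply, Pi.smul_apply, smul_eq_mul, latticeVec_insert _ hc',
        latticeVec_insert _ hi, latticeVec_insert _ hc]
      have hs : (w - w ^ 3) ^ 2 = 2 := by linear_combination (w ^ 2 - 2) * hw
      generalize w - w ^ 3 = s at *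
      cases x t <;> cases x c <;> simp
      linear_combination (-s * latticeVec s u x) * hs

/-- Up to the factor `√2 ^ (n + k)`, a circuit with `k` gates `T` produces a lattice vector. -/
theorem outputOver_mem_lattice {h w : A} (hw : w ^ 4 = -1) (hh : h * (w - w ^ 3) = 1)
    (C : List (Gate n)) :
    (w - w ^ 3) ^ (n + C.countP Gate.isT) • outputOver h w C ∈ lattice w n := by
  induction C using List.reverseRecOn with
  | nil =>
    -- `√2 ^ n |0⋯0⟩` is the generator with factor `√2|0⟩` at all qubits, whence the exponent `n`.
    convert latticeVec_mem w Finset.univ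
    funext x
    simp [outputOver, latticeVec, funext_iff]
  | append_singleton C g ih =>
    rw [outputOver_concat, List.countP_append]
    have hzero : ∀ g : Gate n, g.isT = false → (∀ u, g.lin h w (latticeVec (w - w ^ 3) u) ∈
        lattice w n) → (w - w ^ 3) ^ (n + (C.countP Gate.isT + [g].countP Gate.isT)) •
          g.lin h w (outputOver h w C) ∈ lattice w n := fun g hg hf => by
      rw [← map_smul]
      simpa [List.countP_singleton, hg] using map_mem_lattice _ hf ih
    cases g with
    | H i => exact hzero _ rfl (hadamardGate_mem_lattice hw hh i)
    | S i =>
      refine hzero _ rfl fun u => ?_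
      have := diagGate_mem_lattice (m := 1) (ζ := w ^ 2) (c := -w ^ 3) (w := w) (one_mem _)
        (by simpa using pow_mem (self_mem w) 2) (neg_mem (pow_mem (self_mem w) 3))
        (by linear_combination (1 - w ^ 2) * hw) i u
      rwa [one_smul] at this
    | T i =>
      have hf := map_mem_lattice ((w - w ^ 3) • diagGate i w)
        (diagGate_mem_lattice (sqrtTwo_mem w) (mul_mem (sqrtTwo_mem w) (self_mem w))
          (sub_mem (one_mem _) (self_mem w)) (mul_comm _ _) i) ih
      convert hf using 1
      rw [LinearMap.smul_apply, map_smul, smul_smul, ← pow_succ']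
      rfl
    | CNOT c t hct => exact hzero _ rfl (cnotGate_mem_lattice hw hct)

theorem lattice_apply_mem {w : A} {ψ : (Fin n → Bool) → A} (hψ : ψ ∈ lattice w n)
    (x : Fin n → Bool) : ψ x ∈ Algebra.adjoin ℤ {w} := by
  induction hψ using Submodule.span_induction with
  | mem _ h =>
    obtain ⟨u, rfl⟩ := h
    simp only [latticeVec]
    split_ifs
    · exact pow_mem (sqrtTwo_mem w) _
    · exact zero_mem _
  | zero => exact zero_mem _
  | add _ _ _ _ h h' => exact add_mem h h'
  | smul c ψ _ h => exact mul_mem c.2 h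

theorem exists_of_mem_adjoin {w : A} (hw : w ^ 4 = -1) {z : A}
    (hz : z ∈ Algebra.adjoin ℤ {w}) :
    ∃ a b c d : ℤ, z = a + b * w + c * w ^ 2 + d * w ^ 3 := by
  induction hz using Algebra.adjoin_induction with
  | mem z h =>
    rw [Set.mem_singleton_iff] at h
    exact ⟨0, 1, 0, 0, by simp [h]⟩
  | algebraMap r => exact ⟨r, 0, 0, 0, by simp⟩
  | add _ _ _ _ h h' =>
    obtain ⟨a, b, c, d, rfl⟩ := h
    obtain ⟨a', b', c', d', rfl⟩ := h'
    exact ⟨a + a', b + b', c + c', d + d', by push_cast; ring⟩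
  | mul _ _ _ _ h h' =>
    obtain ⟨a, b, c, d, rfl⟩ := h
    obtain ⟨a', b', c', d', rfl⟩ := h'
    refine ⟨a * a' - b * d' - c * c' - d * b', a * b' + b * a' - c * d' - d * c',
      a * c' + b * b' + c * a' - d * d', a * d' + b * c' + c * b' + d * a', ?_⟩
    push_cast
    linear_combination (b * d' + c * c' + d * b' + (c * d' + d * c') * w + d * d' * w ^ 2) * hw

end Circuit

/-! ## Amplitudes of circuits -/

section Norm

variable {n : ℕ}

/-- Only `|h|` and `|w|` matter, so this covers both `(1/√2, ω)` and its conjugate `(-1/√2, -ω)`.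
For `H`, the entries are paired along qubit `i` and the parallelogram law is applied. -/
theorem sum_norm_sq_lin {h w : ℂ} (hh : ‖h‖ ^ 2 = 1 / 2) (hw : ‖w‖ = 1) (g : Gate n)
    (ψ : QState n) : ∑ x, ‖g.lin h w ψ x‖ ^ 2 = ∑ x, ‖ψ x‖ ^ 2 := by
  have hdiag : ∀ (i : Fin n) (ζ : ℂ), ‖ζ‖ = 1 →
      ∑ x, ‖diagGate i ζ ψ x‖ ^ 2 = ∑ x, ‖ψ x‖ ^ 2 := fun i ζ hζ =>
    Finset.sum_congr rfl fun x _ => by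
      simp only [diagGate, LinearMap.coe_mk, AddHom.coe_mk, norm_mul]
      split_ifs <;> simp [hζ]
  cases g with
  | S i => exact hdiag i _ (by rw [norm_pow, hw, one_pow])
  | T i => exact hdiag i _ hw
  | CNOT c t hct =>
    have hinv : Function.Involutive
        fun x : Fin n → Bool => Function.update x t (xor (x t) (x c)) := fun x => by
      simp [Function.update_of_ne hct]
    exact Equiv.sum_comp (Function.Involutive.toPerm _ hinv) fun x => ‖ψ x‖ ^ 2
  | H i =>
    have hinv : Function.Involutive fun x : Fin n → Bool => Function.update x i (!x i) :=
      fun x => by simp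
    have hsum : ∀ f : (Fin n → Bool) → ℝ,
        ∑ x, (f x + f (Function.update x i (!x i))) = 2 * ∑ x, f x := fun f => by
      rw [Finset.sum_add_distrib, two_mul]
      exact congrArg _ (Equiv.sum_comp (Function.Involutive.toPerm _ hinv) f)
    refine mul_left_cancel₀ (two_ne_zero (α := ℝ)) ?_
    rw [← hsum, ← hsum]
    refine Finset.sum_congr rfl fun x _ => ?_
    have hx : ∀ b, x i = b → Function.update x i b = x := fun b h => by
      rw [← h, Function.update_eq_self]
    have hpar := parallelogram_law_with_norm ℝ (ψ (Function.update x i false))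
      (ψ (Function.update x i true))
    simp only [Gate.lin, hadamardGate, LinearMap.coe_mk, AddHom.coe_mk, norm_mul, mul_pow, hh,
      Function.update_idem, Function.update_self]
    cases hb : x i
    · simp only [Bool.not_false, Bool.false_eq_true, if_false, if_true, one_mul, neg_mul,
        ← sub_eq_add_neg]
      rw [hx _ hb] at hpar ⊢
      linarith
    · simp only [Bool.not_true, Bool.false_eq_true, if_false, if_true, one_mul, neg_mul,
        ← sub_eq_add_neg]
      rw [hx _ hb] at hpar ⊢
      linarith

theorem sum_norm_sq_outputOver {h w : ℂ} (hh : ‖h‖ ^ 2 = 1 / 2) (hw : ‖w‖ = 1)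
    (C : List (Gate n)) : ∑ x, ‖outputOver h w C x‖ ^ 2 = 1 := by
  induction C using List.reverseRecOn with
  | nil =>
    rw [Finset.sum_eq_single fun _ => false]
    · simp [outputOver]
    · intro x _ hx
      simp [outputOver, hx]
    · simp
  | append_singleton C g ih => rw [outputOver_concat, sum_norm_sq_lin hh hw, ih]

theorem norm_outputOver_le {h w : ℂ} (hh : ‖h‖ ^ 2 = 1 / 2) (hw : ‖w‖ = 1) (C : List (Gate n))
    (x : Fin n → Bool) : ‖outputOver h w C x‖ ≤ 1 := by
  have h1 := Finset.single_le_sum (f := fun x => ‖outputOver h w C x‖ ^ 2)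
    (fun x _ => sq_nonneg _) (Finset.mem_univ x)
  rw [sum_norm_sq_outputOver hh hw] at h1
  exact (sq_le_one_iff₀ (norm_nonneg _)).1 h1

/-- The number `exp (iπ/4)`. -/
def omega : ℂ := (1 + Complex.I) / (Real.sqrt 2 : ℂ)

theorem exp_eq_omega : Complex.exp (Complex.I * Real.pi / 4) = omega := by
  have h : Complex.I * Real.pi / 4 = ((Real.pi / 4 : ℝ) : ℂ) * Complex.I := by
    push_cast
    ring
  rw [h, Complex.exp_mul_I, ← Complex.ofReal_cos, ← Complex.ofReal_sin, Real.cos_pi_div_four,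
    Real.sin_pi_div_four, omega, eq_div_iff sqrt_two_ne_zero]
  push_cast
  linear_combination (1 + Complex.I) / 2 * sqrt_two_sq

theorem omega_sq : omega ^ 2 = Complex.I := by
  rw [omega, div_pow, sqrt_two_sq]
  linear_combination Complex.I_sq / 2

theorem sqrt_two_mul_omega : (Real.sqrt 2 : ℂ) * omega = 1 + Complex.I :=
  mul_div_cancel₀ _ sqrt_two_ne_zero

theorem norm_omega : ‖omega‖ = 1 := by
  rw [← exp_eq_omega, mul_div_assoc, mul_comm]
  have : (Real.pi / 4 : ℂ) = ((Real.pi / 4 : ℝ) : ℂ) := by push_cast; rfl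
  rw [this, Complex.norm_exp_ofReal_mul_I]

theorem norm_one_div_sqrt_two_sq : ‖(1 / (Real.sqrt 2 : ℂ))‖ ^ 2 = 1 / 2 := by
  rw [← norm_pow, div_pow, sqrt_two_sq]
  norm_num

theorem output_eq (C : List (Gate n)) :
    output C = outputOver (1 / (Real.sqrt 2 : ℂ)) omega C := by
  induction C using List.reverseRecOn with
  | nil => rfl
  | append_singleton C g ih =>
    rw [outputOver_concat, ← ih, output, List.foldl_append, List.foldl_cons, List.foldl_nil,
      ← output]
    cases g with
    | H i =>
      funext x
      simp only [Gate.apply, Gate.lin, hadamardGate, LinearMap.coe_mk, AddHom.coe_mk]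
      ring
    | S i =>
      simp only [Gate.apply, Gate.lin, diagGate, LinearMap.coe_mk, AddHom.coe_mk, omega_sq]
    | T i =>
      simp only [Gate.apply, Gate.lin, diagGate, LinearMap.coe_mk, AddHom.coe_mk, exp_eq_omega]
    | CNOT c t h => rfl

/-- Half the sum and half the difference of the conjugates `α ± βω` bound the Gaussian integers `α`
and `β`. One conjugate alone would not suffice, as `ℤ[ω]` is dense in `ℂ`. -/
theorem abs_le_of_norm_add_sub {a c b d : ℤ} {N : ℕ}
    (h : ‖((a : ℂ) + c * Complex.I) + (b + d * Complex.I) * omega‖ ≤ 2 ^ N)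
    (h' : ‖((a : ℂ) + c * Complex.I) - (b + d * Complex.I) * omega‖ ≤ 2 ^ N) :
    |a| ≤ 2 ^ N ∧ |b| ≤ 2 ^ N ∧ |c| ≤ 2 ^ N ∧ |d| ≤ 2 ^ N := by
  have h1 : ‖(a : ℂ) + c * Complex.I‖ ≤ 2 ^ N := by
    have := norm_add_le (((a : ℂ) + c * Complex.I) + (b + d * Complex.I) * omega)
      (((a : ℂ) + c * Complex.I) - (b + d * Complex.I) * omega)
    rw [add_add_sub_cancel, ← two_mul, norm_mul, Complex.norm_ofNat] at this
    linarith
  have h2 : ‖(b : ℂ) + d * Complex.I‖ ≤ 2 ^ N := by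
    have := norm_sub_le (((a : ℂ) + c * Complex.I) + (b + d * Complex.I) * omega)
      (((a : ℂ) + c * Complex.I) - (b + d * Complex.I) * omega)
    rw [add_sub_sub_cancel, ← two_mul, norm_mul, norm_mul, norm_omega, Complex.norm_ofNat,
      mul_one] at this
    linarith
  have key : ∀ p q : ℤ, ‖(p : ℂ) + q * Complex.I‖ ≤ 2 ^ N → |p| ≤ 2 ^ N ∧ |q| ≤ 2 ^ N := by
    intro p q hpq
    have hp := (Complex.abs_re_le_norm _).trans hpq
    have hq := (Complex.abs_im_le_norm _).trans hpq
    simp only [Complex.add_re, Complex.add_im, Complex.mul_re, Complex.mul_im, Complex.I_re,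
      Complex.I_im, Complex.intCast_re, Complex.intCast_im, mul_zero, mul_one, sub_zero, add_zero,
      zero_add] at hp hq
    exact ⟨by exact_mod_cast hp, by exact_mod_cast hq⟩
  exact ⟨(key a c h1).1, (key b d h2).1, (key a c h1).2, (key b d h2).2⟩

theorem output_mem_height (C : List (Gate n)) (x : Fin n → Bool) :
    output C x ∈ Height (n + C.countP Gate.isT + 1) := by
  set N := n + C.countP Gate.isT with hN
  set s : ℂ := (Real.sqrt 2 : ℂ) with hs
  have hs2 : s ^ 2 = 2 := sqrt_two_sq
  -- The components are the two embeddings of `ℚ(ω)` that fix `i`. In the product ring the integer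
  -- coordinates found below are shared by both.
  set W : ℂ × ℂ := (omega, -omega) with hW
  set H : ℂ × ℂ := (1 / s, -(1 / s)) with hH
  have hω4 : omega ^ 4 = -1 := by
    rw [show omega ^ 4 = (omega ^ 2) ^ 2 by ring, omega_sq, Complex.I_sq]
  have hωs : omega - omega ^ 3 = s := by
    have h1 : omega ^ 3 = Complex.I * omega := by rw [← omega_sq]; ring
    have h2 : s * omega = 1 + Complex.I := sqrt_two_mul_omega
    refine mul_left_cancel₀ sqrt_two_ne_zero ?_
    rw [h1, ← hs]
    linear_combination (1 - Complex.I) * h2 - Complex.I_sq - hs2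
  have hW4 : W ^ 4 = -1 := by
    ext
    · exact hω4
    · change (-omega) ^ 4 = -1
      rw [Even.neg_pow (by decide), hω4]
  have hWs : W - W ^ 3 = (s, -s) := by
    ext
    · exact hωs
    · change -omega - (-omega) ^ 3 = -s
      rw [← hωs]
      ring
  have hHW : H * (W - W ^ 3) = 1 := by
    rw [hWs]
    ext
    · exact one_div_mul_cancel sqrt_two_ne_zero
    · change -(1 / s) * -s = 1
      rw [neg_mul_neg]
      exact one_div_mul_cancel sqrt_two_ne_zero
  -- A second factor `√2 ^ N` turns the denominator into the rational number `2 ^ N`, which is the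
  -- same in both components.
  have hmem := lattice_apply_mem (smul_mem_lattice (pow_mem (sqrtTwo_mem W) N)
    (outputOver_mem_lattice hW4 hHW C)) x
  obtain ⟨a, b, c, d, habcd⟩ := exists_of_mem_adjoin hW4 hmem
  have h4 : (W - W ^ 3) ^ N * (W - W ^ 3) ^ N = 2 ^ N := by
    rw [← mul_pow, hWs]
    congr 1
    ext
    · exact (pow_two s).symm.trans hs2
    · exact (neg_mul_neg s s).trans ((pow_two s).symm.trans hs2)
  rw [Pi.smul_apply, Pi.smul_apply, smul_eq_mul, smul_eq_mul, ← mul_assoc, h4] at habcd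
  have hfst := congrArg (RingHom.fst ℂ ℂ) habcd
  have hsnd := congrArg (RingHom.snd ℂ ℂ) habcd
  simp only [map_mul, map_add, map_pow, map_intCast, map_ofNat, map_outputOver] at hfst hsnd
  change 2 ^ N * outputOver (1 / s) omega C x = a + b * omega + c * omega ^ 2 + d * omega ^ 3
    at hfst
  change 2 ^ N * outputOver (-(1 / s)) (-omega) C x =
    a + b * -omega + c * (-omega) ^ 2 + d * (-omega) ^ 3 at hsnd
  have hn1 := norm_outputOver_le norm_one_div_sqrt_two_sq norm_omega C x
  have hn2 := norm_outputOver_le (h := -(1 / s)) (w := -omega)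
    (by rw [norm_neg]; exact norm_one_div_sqrt_two_sq) (by rw [norm_neg]; exact norm_omega) C x
  rw [← output_eq] at hn1
  rw [← output_eq] at hfst
  have e1 : ((a : ℂ) + c * Complex.I) + (b + d * Complex.I) * omega = 2 ^ N * output C x := by
    rw [hfst, ← omega_sq]
    ring
  have e2 : ((a : ℂ) + c * Complex.I) - (b + d * Complex.I) * omega =
      2 ^ N * outputOver (-(1 / s)) (-omega) C x := by
    rw [hsnd, ← omega_sq]
    ring
  have hnorm : ∀ z : ℂ, ‖z‖ ≤ 1 → ‖2 ^ N * z‖ ≤ 2 ^ N := fun z hz => by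
    rw [norm_mul, norm_pow, Complex.norm_ofNat]
    exact mul_le_of_le_one_right (by positivity) hz
  obtain ⟨ha, hb, hc, hd⟩ := abs_le_of_norm_add_sub (N := N) (a := a) (b := b) (c := c) (d := d)
    (by rw [e1]; exact hnorm _ hn1) (by rw [e2]; exact hnorm _ hn2)
  have h2N : (2 : ℤ) ^ (N + 1) = 2 * 2 ^ N := pow_succ' _ _
  rw [abs_le] at ha hb hc hd
  -- Since `2ω = √2(1 + i)`, doubling passes from the basis `1, ω, ω², ω³` to `1, √2, i, i√2`; the
  -- doubling accounts for the exponent `N + 1`.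
  refine ⟨2 * a, b - d, 2 * c, b + d, 2 ^ (N + 1), by positivity, le_rfl, ?_, ?_, ?_, ?_, ?_⟩
  · rw [h2N, abs_le]
    constructor <;> linarith
  · rw [h2N, abs_le]
    constructor <;> linarith
  · rw [h2N, abs_le]
    constructor <;> linarith
  · rw [h2N, abs_le]
    constructor <;> linarith
  · have hso : 2 * omega = s * (1 + Complex.I) := by
      have h2 : s * omega = 1 + Complex.I := sqrt_two_mul_omega
      linear_combination s * h2 - omega * hs2
    push_cast
    rw [pow_succ, ← mul_assoc, mul_comm (output C x), ← e1, quad]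
    push_cast
    linear_combination (b + d * Complex.I) * hso + s * d * Complex.I_sq

end Norm

/-! ## Heights of the computed values -/

theorem phases_subset_height {n m : ℕ} {ψ : QState n} (h : ∀ x, ψ x ∈ Height m) :
    phases ψ ⊆ Height (m + 3) := by
  have h0 : ∀ a c : ℤ, |a| ≤ 1 → |c| ≤ 1 → (a + c * Complex.I : ℂ) ∈ Height 0 :=
    fun a c ha hc => ⟨a, 0, c, 0, 1, one_ne_zero, le_rfl, ha, by simp, hc, by simp, by simp [quad]⟩
  rintro _ ⟨u, w, hu, rfl, hw⟩
  have hu' : u ∈ Height 0 := by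
    rcases pow_four_eq_one_cases hu with rfl | rfl | rfl | rfl
    · simpa using h0 1 0 (by simp) (by simp)
    · simpa using h0 (-1) 0 (by simp) (by simp)
    · simpa using h0 0 1 (by simp) (by simp)
    · simpa using h0 0 (-1) (by simp) (by simp)
  have hw' : w ∈ Height m := by
    rcases hw with rfl | rfl | ⟨x, rfl⟩
    · exact Height.mono (Nat.zero_le _) (by simpa using h0 0 0 (by simp) (by simp))
    · exact Height.mono (Nat.zero_le _) (by simpa using h0 1 0 (by simp) (by simp))
    · exact h x
  exact Height.mono (by omega) (Height.mul_mem hu' hw')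

theorem amplitudes_div_subset_height {G : Set ℂ} {m : ℕ} (h : G ⊆ Height m) :
    Amplitudes G / Amplitudes G ⊆ Height (60 * m + 215) := by
  have hr : ∀ r ∈ ({1, (Real.sqrt 2 : ℂ)} : Set ℂ), r ∈ Height 0 := by
    rintro r (rfl | rfl)
    · exact ⟨1, 0, 0, 0, 1, one_ne_zero, le_rfl, by simp, by simp, by simp, by simp,
        by simp [quad]⟩
    · exact ⟨0, 1, 0, 0, 1, one_ne_zero, le_rfl, by simp, by simp, by simp, by simp,
        by simp [quad]⟩
  have h2 : ∀ z ∈ G * G, z ∈ Height (2 * m + 3) := by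
    rintro _ ⟨x, hx, y, hy, rfl⟩
    exact Height.mono (by omega) (Height.mul_mem (h hx) (h hy))
  -- The sum has height `2(2m + 3) + 1`, the division adds `4(2m + 3) + 10`, and the division by `1`
  -- or `√2` adds `10`.
  have hA : ∀ z ∈ Amplitudes G, z ∈ Height (12 * m + 39) := by
    rintro _ ⟨_, ⟨_, ⟨x, hx, y, hy, rfl⟩, z, hz, rfl⟩, r, hr', rfl⟩
    exact Height.mono (by omega) (Height.div_mem
      (Height.div_mem (Height.add_mem (h2 x hx) (h2 y hy)) (h2 z hz)) (hr r hr'))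
  rintro _ ⟨x, hx, y, hy, rfl⟩
  exact Height.mono (by omega) (Height.div_mem (hA x hx) (hA y hy))

theorem exists_output_ne_zero {n : ℕ} (C : List (Gate n)) : ∃ x, output C x ≠ 0 := by
  by_contra! h
  have := sum_norm_sq_outputOver norm_one_div_sqrt_two_sq norm_omega C
  rw [← output_eq] at this
  simp [h] at this

end QDD

end

/-! ### The main theorem. -/

theorem mainTheorem1 :
    ∃ c : ℕ, ∀ (n : ℕ) (_ : 0 < n) (O : QDD.Orders) (K : QDD.Kind) (r : QDD.Edge n) (k : ℕ),
      r.Normalized K → QDD.HasTCount r.vec k →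
        ∀ z : ℂ, QDD.Computed O K r z → z ∈ QDD.R (c * (n + k)) := by
  -- The bound is `60(n + k + 4) + 215 = 60(n + k) + 455`, which is at most `515(n + k)` because `n
  -- ≥ 1`.
  refine ⟨515, fun n hn O K r k hr hk z hz => ?_⟩
  obtain ⟨C, hC, hCk⟩ := hk.1
  have hne : ∃ x, r.vec x ≠ 0 := hC ▸ QDD.exists_output_ne_zero C
  have hm : ∀ x, r.vec x ∈ QDD.Height (n + k + 1) := fun x => by
    rw [← hC, ← hCk]
    exact QDD.output_mem_height C x
  exact QDD.Height.subset_R _ (QDD.Height.mono (by omega)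
    (QDD.amplitudes_div_subset_height (QDD.phases_subset_height hm)
      (hr.mem_div_of_computed O hne hz)))
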